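/- Let $k$ be an algebraically closed field of characteristic $0$. A rational function of degree $3$ on $\mathbb P^1$ over $k$ is a map $\phi=[f_0:f_1]:\mathbb P^1\to\mathbb P^1$ given by two binary cubic forms $f_0(x,y),f_1(x,y)$ over $k$ with no common root on $\mathbb P^1$; write $z=x/y$. Its automorphism group is $\mathrm{Aut}(\phi)=\{\sigma\in \mathrm{PGL}_2(k):\phi\circ\sigma=\sigma\circ\phi\}$, and $\phi,\psi$ are called conjugate if $\psi=\sigma^{-1}\circ\phi\circ\sigma$ for some $\sigma\in \mathrm{PGL}_2(k)$. Consider the following cubic rational functions, for $t,s\in k$: $$L_1(t,s)=\frac{z^3+tz}{sz^2+1},\quad L_2(t,s)=\frac{sz^2+1}{z^3+tz}\quad(ts\neq1),\qquad L_3(t)=\frac{z^3-t}{-tz^2}\quad(t\ne0),$$ $$L_4(t)=\frac{tz^2+1}{z^3+tz},\quad L_5(t)=\frac{tz^2-1}{z^3-tz}\quad(t^2\ne1),\qquad L_6=\frac{z^3-3}{-3z^2},\qquad L_7=\frac1{z^3}.$$ Let $\phi$ be a rational function of degree $3$ on $\mathbb P^1$ over $k$. Then the following hold. 1. Every element of $\mathrm{Aut}(\phi)$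 has finite order, and this order is at most $4$. 2. $\mathrm{Aut}(\phi)$ is isomorphic to one of $\{e\}$, $C_2$, $C_3$, $C_4$, $V_4=C_2\times C_2$, $D_4$ (the dihedral group of order $8$), $A_4$. In particular, it is isomorphic neither to $S_4$ nor to $A_5$. 3. $\mathrm{Aut}(\phi)$ contains an element of order $2$ if and only if $\phi$ is conjugate to some $L_1(t,s)$ or $L_2(t,s)$ with $ts\ne1$. It contains an element of order $3$ if and only if $\phi$ is conjugate to some $L_3(t)$ with $t\neq0$. It contains an element of order $4$ if and only if $\phi$ is conjugate to $L_7$. It contains a subgroup isomorphic to $V_4$ if and only if $\phi$ is conjugate to some $L_4(t)$ or $L_5(t)$ with $t^2\neq1$. 4. The automorphism group is determined by the normal form as follows. - $\mathrm{Aut}(\phi)\cong C_2$ if and only if $\phi$ is conjugate to some $L_1(t,s)$ with $ts\ne1$, $t\neq s$, or to some $L_2(t,s)$ with $ts\neq1$, $t^2\ne s^2$. - $\mathrm{Aut}(\phi)\cong C_3$ if and only if $\phi$ is conjugate to some $L_3(t)$ with $t\ne0,3$. - $\mathrm{Aut}(\phi)\cong V_4$ if and only if $\phi$ is conjugate to some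 $L_4(t)$ with $t\neq0$, $t^2\ne1$, or to some $L_5(t)$ with $t^2\notin\{0,1,9,-3\}$. - $\mathrm{Aut}(\phi)\cong A_4$ if and only if $\phi$ is conjugate to $L_6$. - $\mathrm{Aut}(\phi)\cong D_4$ if and only if $\phi$ is conjugate to $L_7$. -/

import Mathlib

open scoped MatrixGroups LinearAlgebra.Projectivization

/-- A degree `d` rational function `φ = [f₀ : f₁]` on the projective line over `k`: a pair of binary
forms of degree `d` in `x = X 0`, `y = X 1` with no common root on the projective line (used for `k`
algebraically closed, where this says that the resultant is nonzero). -/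
structure RationalFunction (k : Type*) [Field k] (d : ℕ) where
  f₀ : MvPolynomial (Fin 2) k
  f₁ : MvPolynomial (Fin 2) k
  homogeneous₀ : f₀.IsHomogeneous d
  homogeneous₁ : f₁.IsHomogeneous d
  noCommonRoot : ∀ v : Fin 2 → k, v ≠ 0 →
    ¬ (MvPolynomial.eval v f₀ = 0 ∧ MvPolynomial.eval v f₁ = 0)

/-- A form of degree `d` satisfies `f (a v) = a ^ d f (v)`. -/
theorem eval_smul_of_isHomogeneous {k : Type*} [Field k] {d : ℕ} {f : MvPolynomial (Fin 2) k}
    (hf : f.IsHomogeneous d) (a : k) (v : Fin 2 → k) :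
    MvPolynomial.eval (a • v) f = a ^ d * MvPolynomial.eval v f := by
  simp only [MvPolynomial.eval_eq', Finset.mul_sum, Fin.prod_univ_two, Pi.smul_apply, smul_eq_mul]
  refine Finset.sum_congr rfl fun m hm => ?_
  have h := hf (MvPolynomial.mem_support_iff.mp hm)
  simp only [Finsupp.weight_apply, Finsupp.sum_fintype, Fin.sum_univ_two, Pi.one_apply,
    smul_eq_mul, mul_one, implies_true] at h
  rw [← h]
  ring

namespace RationalFunction

variable {k : Type*} [Field k] {d : ℕ}

/-- The vector `(f₀(v), f₁(v))`. -/
noncomputable def evalVec (φ : RationalFunction k d) (v : Fin 2 → k) : Fin 2 → k :=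
  ![MvPolynomial.eval v φ.f₀, MvPolynomial.eval v φ.f₁]

theorem evalVec_ne_zero (φ : RationalFunction k d) {v : Fin 2 → k} (hv : v ≠ 0) :
    φ.evalVec v ≠ 0 := fun h =>
  φ.noCommonRoot v hv ⟨by simpa [evalVec] using congrFun h 0, by simpa [evalVec] using congrFun h 1⟩

theorem evalVec_smul (φ : RationalFunction k d) (a : k) (v : Fin 2 → k) :
    φ.evalVec (a • v) = a ^ d • φ.evalVec v := by
  ext i
  fin_cases i
  · simp [evalVec, eval_smul_of_isHomogeneous φ.homogeneous₀]
  · simp [evalVec, eval_smul_of_isHomogeneous φ.homogeneous₁]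

/-- The self-map `[x : y] ↦ [f₀(x, y) : f₁(x, y)]` of the projective line. -/
noncomputable def toMap (φ : RationalFunction k d) : ℙ k (Fin 2 → k) → ℙ k (Fin 2 → k) :=
  Projectivization.lift
    (fun v => Projectivization.mk k (φ.evalVec v.1) (φ.evalVec_ne_zero v.2)) (by
      rintro a b t h
      rw [Projectivization.mk_eq_mk_iff']
      exact ⟨t ^ d, by rw [h, evalVec_smul]⟩)

/-- The automorphism group: all `σ ∈ PGL₂(k)` with `φ ∘ σ = σ ∘ φ`, where `PGL₂(k)` acts on the
projective line by `(a, b; c, e) • [x : y] = [a x + b y : c x + e y]`. -/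
def Aut (φ : RationalFunction k d) : Subgroup PGL(2, k) where
  carrier := {σ | ∀ p : ℙ k (Fin 2 → k), φ.toMap (σ • p) = σ • φ.toMap p}
  one_mem' := fun p => by simp
  mul_mem' := fun {σ τ} hσ hτ p => by rw [mul_smul, mul_smul, hσ, hτ]
  inv_mem' := fun {σ} hσ p => by
    have h := hσ (σ⁻¹ • p)
    rw [smul_inv_smul] at h
    rw [h, inv_smul_smul]

/-- `φ` and `ψ` are conjugate: `ψ = σ⁻¹ ∘ φ ∘ σ` for some `σ ∈ PGL₂(k)`. -/
def IsConj (φ ψ : RationalFunction k d) : Prop :=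
  ∃ σ : PGL(2, k), ∀ p : ℙ k (Fin 2 → k), ψ.toMap p = σ⁻¹ • φ.toMap (σ • p)

end RationalFunction

/-- The binary cubic form `c₀ x³ + c₁ x² y + c₂ x y² + c₃ y³`. -/
noncomputable def binaryCubic {k : Type*} [Field k] (c : Fin 4 → k) : MvPolynomial (Fin 2) k :=
  ∑ i : Fin 4, MvPolynomial.C (c i) *
    (MvPolynomial.X 0 ^ (3 - (i : ℕ)) * MvPolynomial.X 1 ^ (i : ℕ))

namespace RationalFunction

variable {k : Type*} [Field k]

/-- `φ` is conjugate to the cubic rational function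
`z ↦ (a₀ z³ + a₁ z² + a₂ z + a₃) / (b₀ z³ + b₁ z² + b₂ z + b₃)`, where `z = x / y`; in particular
this quotient is required to have degree exactly three. -/
def IsConjToCubic (φ : RationalFunction k 3) (a b : Fin 4 → k) : Prop :=
  ∃ ψ : RationalFunction k 3, ψ.f₀ = binaryCubic a ∧ ψ.f₁ = binaryCubic b ∧ φ.IsConj ψ

/-- `φ` is conjugate to `(z³ + t z) / (s z² + 1)`. -/
def IsL₁ (φ : RationalFunction k 3) (t s : k) : Prop :=
  φ.IsConjToCubic ![1, 0, t, 0] ![0, s, 0, 1]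

/-- `φ` is conjugate to `(s z² + 1) / (z³ + t z)`. -/
def IsL₂ (φ : RationalFunction k 3) (t s : k) : Prop :=
  φ.IsConjToCubic ![0, s, 0, 1] ![1, 0, t, 0]

/-- `φ` is conjugate to `(z³ - t) / (-t z²)`. -/
def IsL₃ (φ : RationalFunction k 3) (t : k) : Prop :=
  φ.IsConjToCubic ![1, 0, 0, -t] ![0, -t, 0, 0]

/-- `φ` is conjugate to `(t z² + 1) / (z³ + t z)`. -/
def IsL₄ (φ : RationalFunction k 3) (t : k) : Prop :=
  φ.IsConjToCubic ![0, t, 0, 1] ![1, 0, t, 0]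

/-- `φ` is conjugate to `(t z² - 1) / (z³ - t z)`. -/
def IsL₅ (φ : RationalFunction k 3) (t : k) : Prop :=
  φ.IsConjToCubic ![0, t, 0, -1] ![1, 0, -t, 0]

/-- `φ` is conjugate to `(z³ - 3) / (-3 z²)`. -/
def IsL₆ (φ : RationalFunction k 3) : Prop :=
  φ.IsConjToCubic ![1, 0, 0, -3] ![0, -3, 0, 0]

/-- `φ` is conjugate to `1 / z³`. -/
def IsL₇ (φ : RationalFunction k 3) : Prop :=
  φ.IsConjToCubic ![0, 0, 0, 1] ![1, 0, 0, 0]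

end RationalFunction

/-! Up to conjugacy an element of PGL₂(k) is either z ↦ z + 1 or z ↦ uz. In characteristic 0 a cubic
map never commutes with a translation (`translation_notMem_aut`). If φ = [p : q] commutes with z ↦
uz, every nonzero coefficient of p or q pins the proportionality scalar to a power of u. Since ∞ and
0 are not common roots, two nonzero coefficients are available; equating their powers shows that u
has order 1, 2, 3 or 4 and kills most other coefficients (`coeffs_of_diag_mem_aut`). Rescaling z
then gives L₁ or L₂ (order 2), L₃ (order 3) and L₇ (order 4).

The groups of L₃(t) and L₇ are computed from coefficient equations. For L₇ the result is D₄, so an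
element of order 4 always brings D₄ with it and C₄ never occurs. For L₃(t) the result is C₃ unless t
= 3. The map L₃(3) is L₆, and its group acts on the four fixed points as A₄ (`HasCoeffs.aut_L₆`).

If no automorphism has order 3 or 4, all are involutions and commute. After conjugation one of them
is z ↦ -z, whose centralizer consists of the maps uz and l/z, so the group is trivial, C₂ or V₄
(`aut_of_exponent_two`). A Klein four-group can be moved to the one generated by -z and 1/z, which
gives L₄ or L₅ (`isL₄_or_isL₅_of_klein`).

It remains to find the parameters at which V₄ grows. If φ = [f₀ : f₁], the fixed points are the
zeros of the binary quartic x f₁ - y f₀, and conjugation by σ substitutes σ into this quartic, up to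
a scalar. It is x⁴ - y⁴ for L₄ and L₇, x⁴ - 2t x²y² + y⁴ for L₅, and -4x³y + 3y⁴ for L₆. The
classical invariants of degree 2 and 3 of quartics rule out conjugacy of L₅(t) to L₆ unless t² = -3,
and to L₇ unless t(t² - 9) = 0; for L₄ individual coefficients of the quartic are compared. -/

/-! ### Binary cubic forms and proportional pairs -/

/-- The value of the binary cubic form with coefficients `p` at `(x, y)`. -/
def cubicValue {k : Type*} [Field k] (p : Fin 4 → k) (x y : k) : k :=
  p 0 * x ^ 3 + p 1 * x ^ 2 * y + p 2 * x * y ^ 2 + p 3 * y ^ 3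

section Forms

variable {k : Type*} [Field k]

theorem eval_binaryCubic (p : Fin 4 → k) (v : Fin 2 → k) :
    MvPolynomial.eval v (binaryCubic p) = cubicValue p (v 0) (v 1) := by
  simp [binaryCubic, cubicValue, Fin.sum_univ_four]
  ring

theorem isHomogeneous_binaryCubic (p : Fin 4 → k) : (binaryCubic p).IsHomogeneous 3 := by
  unfold binaryCubic
  refine MvPolynomial.IsHomogeneous.sum _ _ _ fun i _ => ?_
  have h := (MvPolynomial.isHomogeneous_C (Fin 2) (p i)).mul
    (((MvPolynomial.isHomogeneous_X k (0 : Fin 2)).pow (3 - (i : ℕ))).mul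
      ((MvPolynomial.isHomogeneous_X k (1 : Fin 2)).pow (i : ℕ)))
  convert h using 1
  omega

theorem exists_eq_binaryCubic {f : MvPolynomial (Fin 2) k} (hf : f.IsHomogeneous 3) :
    ∃ p, f = binaryCubic p := by
  refine ⟨fun i => f.coeff (Finsupp.single 0 (3 - (i : ℕ)) + Finsupp.single 1 (i : ℕ)), ?_⟩
  ext m
  have hmon : ∀ i : Fin 4, (MvPolynomial.X 0 ^ (3 - (i : ℕ)) * MvPolynomial.X 1 ^ (i : ℕ) :
      MvPolynomial (Fin 2) k) =
      MvPolynomial.monomial (Finsupp.single 0 (3 - (i : ℕ)) + Finsupp.single 1 (i : ℕ)) 1 := by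
    intro i
    rw [MvPolynomial.X_pow_eq_monomial, MvPolynomial.X_pow_eq_monomial,
      MvPolynomial.monomial_mul, one_mul]
  simp only [binaryCubic, hmon, MvPolynomial.coeff_sum, MvPolynomial.coeff_C_mul,
    MvPolynomial.coeff_monomial]
  by_cases hm : m 0 + m 1 = 3
  · have hi : m 1 < 4 := by omega
    have hmi : m = Finsupp.single 0 (3 - m 1) + Finsupp.single 1 (m 1) := by
      ext j
      fin_cases j
      · simp; omega
      · simp
    rw [Finset.sum_eq_single (⟨m 1, hi⟩ : Fin 4)]
    · simp only [← hmi, if_true, mul_one]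
    · intro j _ hj
      rw [if_neg, mul_zero]
      intro h
      apply hj
      ext
      simp [← h]
    · simp
  · rw [Finset.sum_eq_zero]
    · by_contra h
      have h := hf h
      simp [Finsupp.weight_apply, Finsupp.sum_fintype, Fin.sum_univ_two] at h
      exact hm h
    · intro j _
      rw [if_neg, mul_zero]
      rintro rfl
      apply hm
      simp
      omega

theorem cubicValue_smul (e : k) (p : Fin 4 → k) (x y : k) :
    cubicValue (e • p) x y = e * cubicValue p x y := by
  simp only [cubicValue, Pi.smul_apply, smul_eq_mul]
  ring

open Polynomial in
/-- Two pairs of cubic forms without common root that are pointwise proportional are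
proportional. -/
theorem exists_smul_of_proportional [IsAlgClosed k] [CharZero k] {p q p' q' : Fin 4 → k}
    (hpq : ∀ x y, (x ≠ 0 ∨ y ≠ 0) → ¬ (cubicValue p x y = 0 ∧ cubicValue q x y = 0))
    (h : ∀ x y, cubicValue p x y * cubicValue q' x y = cubicValue q x y * cubicValue p' x y) :
    ∃ e : k, p' = e • p ∧ q' = e • q := by
  let F : (Fin 4 → k) → k[X] := fun c => C (c 0) * X ^ 3 + C (c 1) * X ^ 2 + C (c 2) * X + C (c 3)
  have hF : ∀ c z, (F c).eval z = cubicValue c z 1 := by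
    intro c z
    simp [F, cubicValue]
  -- Dehomogenize at y = 1: having no common affine root is coprimality over an algebraically closed
  -- field.
  have hcop : IsCoprime (F p) (F q) := by
    rw [isCoprime_iff_aeval_ne_zero_of_isAlgClosed k k]
    intro z
    have := hpq z 1 (Or.inr one_ne_zero)
    rw [coe_aeval_eq_eval, hF, hF]
    tauto
  have hmul : F p * F q' = F q * F p' := by
    apply Polynomial.funext
    intro z
    simp only [eval_mul, hF, h]
  have hdeg : ∀ c, (F c).natDegree ≤ 3 := fun c => natDegree_cubic_le
  -- By coprimality `F a` divides `F a'`. Since `F a` has the full degree 3, the cofactor is a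
  -- constant, and the same constant works for the second forms.
  have key : ∀ {a b a' b' : Fin 4 → k}, IsCoprime (F a) (F b) → a 0 ≠ 0 →
      F a * F b' = F b * F a' → ∃ e : k, F a' = C e * F a ∧ F b' = C e * F b := by
    intro a b a' b' hab ha hm
    have hne : F a ≠ 0 := by
      intro h0
      have := natDegree_cubic (b := a 1) (c := a 2) (d := a 3) ha
      change (F a).natDegree = 3 at this
      rw [h0] at this
      simp at this
    obtain ⟨Q, hQ⟩ : F a ∣ F a' := hab.dvd_of_dvd_mul_left ⟨F b', hm.symm⟩
    have hQ' : ∃ e, Q = C e := by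
      by_cases hQ0 : Q = 0
      · exact ⟨0, by simp [hQ0]⟩
      have h1 := natDegree_mul hne hQ0
      rw [← hQ] at h1
      have h2 : (F a).natDegree = 3 := natDegree_cubic ha
      have h3 := hdeg a'
      exact ⟨_, eq_C_of_natDegree_eq_zero (by omega)⟩
    obtain ⟨e, rfl⟩ := hQ'
    refine ⟨e, by rw [hQ, mul_comm], ?_⟩
    apply mul_left_cancel₀ hne
    rw [hm, hQ]
    ring
  have hext : ∀ {c c' : Fin 4 → k} {e : k}, F c' = C e * F c → c' = e • c := by
    intro c c' e hc
    have h0 := congrArg (fun f => f.coeff 0) hc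
    have h1 := congrArg (fun f => f.coeff 1) hc
    have h2 := congrArg (fun f => f.coeff 2) hc
    have h3 := congrArg (fun f => f.coeff 3) hc
    simp [F, coeff_X, coeff_C, coeff_X_pow] at h0 h1 h2 h3
    ext i
    fin_cases i <;> simpa
  -- The point at infinity, lost in the dehomogenization, is not a common root, so one of the two
  -- forms has degree exactly 3 and can play the role of divisor.
  have hinf := hpq 1 0 (Or.inl one_ne_zero)
  have hinf' : p 0 ≠ 0 ∨ q 0 ≠ 0 := by
    by_contra! h0
    exact hinf (by simp [cubicValue, h0])
  rcases hinf' with h0 | h0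
  · obtain ⟨e, h1, h2⟩ := key hcop h0 hmul
    exact ⟨e, hext h1, hext h2⟩
  · obtain ⟨e, h1, h2⟩ := key hcop.symm h0 hmul.symm
    exact ⟨e, hext h2, hext h1⟩

end Forms

/-! ### Elements of PGL₂(k) as matrices up to scalars, and their conjugacy classes -/

section PGL

variable {k : Type*} [Field k]

/-- The class in `PGL₂(k)` of the matrix `(a, b; c, d)`. -/
noncomputable def pgl (a b c d : k) (h : a * d - b * c ≠ 0) : PGL(2, k) :=
  .mk (Matrix.GeneralLinearGroup.mkOfDetNeZero !![a, b; c, d] (by rwa [Matrix.det_fin_two_of]))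

theorem exists_eq_pgl (σ : PGL(2, k)) : ∃ a b c d, ∃ h : a * d - b * c ≠ 0, σ = pgl a b c d h := by
  obtain ⟨g, rfl⟩ := Matrix.ProjGenLinGroup.mk_surjective σ
  have hg := g.det_ne_zero
  rw [Matrix.det_fin_two] at hg
  refine ⟨_, _, _, _, hg, ?_⟩
  unfold pgl
  congr 1
  ext i j
  fin_cases i <;> fin_cases j <;> rfl

theorem pgl_mul (a b c d a' b' c' d' : k) (h : a * d - b * c ≠ 0) (h' : a' * d' - b' * c' ≠ 0) :
    pgl a b c d h * pgl a' b' c' d' h' =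
      pgl (a * a' + b * c') (a * b' + b * d') (c * a' + d * c') (c * b' + d * d')
        (by convert mul_ne_zero h h' using 1; ring) := by
  unfold pgl
  rw [← map_mul]
  congr 1
  ext i j
  fin_cases i <;> fin_cases j <;>
    simp [Matrix.GeneralLinearGroup.mkOfDetNeZero, Matrix.mul_apply, Fin.sum_univ_two]

theorem pgl_eq_iff {a b c d a' b' c' d' : k} {h : a * d - b * c ≠ 0} {h' : a' * d' - b' * c' ≠ 0} :
    pgl a b c d h = pgl a' b' c' d' h' ↔
      ∃ u : k, u ≠ 0 ∧ a' = u * a ∧ b' = u * b ∧ c' = u * c ∧ d' = u * d := by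
  unfold pgl
  rw [Matrix.ProjGenLinGroup.mk_eq_mk_iff]
  constructor
  · rintro ⟨u, hu⟩
    have hu' := (Matrix.GeneralLinearGroup.ext_iff _ _).1 hu
    have h00 := hu' 0 0
    have h01 := hu' 0 1
    have h10 := hu' 1 0
    have h11 := hu' 1 1
    simp [Matrix.GeneralLinearGroup.mkOfDetNeZero] at h00 h01 h10 h11
    refine ⟨u, u.ne_zero, ?_, ?_, ?_, ?_⟩
    · rw [← h00, mul_comm]
    · rw [← h01, mul_comm]
    · rw [← h10, mul_comm]
    · rw [← h11, mul_comm]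
  · rintro ⟨u, hu, rfl, rfl, rfl, rfl⟩
    refine ⟨Units.mk0 u hu, ?_⟩
    ext i j
    fin_cases i <;> fin_cases j <;>
      simp [Matrix.GeneralLinearGroup.mkOfDetNeZero, mul_comm]

theorem pgl_congr {a b c d a' b' c' d' : k} {h : a * d - b * c ≠ 0}
    (h0 : a = a') (h1 : b = b') (h2 : c = c') (h3 : d = d') :
    pgl a b c d h = pgl a' b' c' d' (by subst h0 h1 h2 h3; exact h) := by
  subst h0 h1 h2 h3; rfl

theorem pgl_one : pgl (1 : k) 0 0 1 (by simp) = 1 := by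
  rw [← Matrix.ProjGenLinGroup.mk_one]
  unfold pgl
  congr 1
  ext i j
  fin_cases i <;> fin_cases j <;> simp [Matrix.GeneralLinearGroup.mkOfDetNeZero]

theorem pgl_eq_one_iff {a b c d : k} {h : a * d - b * c ≠ 0} :
    pgl a b c d h = 1 ↔ b = 0 ∧ c = 0 ∧ a = d := by
  rw [← pgl_one, eq_comm, pgl_eq_iff]
  constructor
  · rintro ⟨u, _, rfl, rfl, rfl, rfl⟩
    simp
  · rintro ⟨rfl, rfl, rfl⟩
    refine ⟨a, ?_, by simp, by simp, by simp, by simp⟩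
    rintro rfl
    simp at h

theorem pgl_smul_mk {a b c d : k} (h : a * d - b * c ≠ 0) {v : Fin 2 → k} (hv : v ≠ 0) :
    ∃ hw : ![a * v 0 + b * v 1, c * v 0 + d * v 1] ≠ 0,
      pgl a b c d h • Projectivization.mk k v hv = Projectivization.mk k _ hw := by
  have key : (Matrix.GeneralLinearGroup.mkOfDetNeZero !![a, b; c, d]
      (by rwa [Matrix.det_fin_two_of])) • v = ![a * v 0 + b * v 1, c * v 0 + d * v 1] := by
    change (!![a, b; c, d]).mulVec v = _
    ext i
    fin_cases i <;> simp [Matrix.mulVec, dotProduct, Fin.sum_univ_two]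
  refine ⟨key ▸ (smul_ne_zero_iff_ne _).2 hv, ?_⟩
  unfold pgl
  rw [Projectivization.PGL.mk_smul_mk]
  congr 1

/-- The diagonal embedding of the multiplicative group in `PGL₂(k)`. -/
noncomputable def pglDiag : kˣ →* PGL(2, k) where
  toFun u := pgl (u : k) 0 0 1 (by simp)
  map_one' := by simpa using pgl_one
  map_mul' u v := by
    rw [pgl_mul]
    exact pgl_congr (by simp) (by simp) (by simp) (by simp)

theorem pglDiag_apply (u : kˣ) : pglDiag u = pgl (u : k) 0 0 1 (by simp) := rfl

theorem pglDiag_injective : Function.Injective (pglDiag (k := k)) := by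
  rw [injective_iff_map_eq_one]
  intro u hu
  rw [pglDiag_apply, pgl_eq_one_iff] at hu
  exact Units.ext hu.2.2

/-- Every element of `PGL₂(k)`, `k` algebraically closed, is conjugate to a diagonal matrix or to
a translation. -/
theorem exists_conj_diag_or_translation [IsAlgClosed k] (σ : PGL(2, k)) :
    ∃ τ : PGL(2, k), (∃ u : kˣ, σ * τ = τ * pglDiag u) ∨
      σ * τ = τ * pgl 1 1 0 1 (by simp) := by
  obtain ⟨a, b, c, d, h, rfl⟩ := exists_eq_pgl σ
  -- conjugate to an upper triangular matrix
  have upper : ∃ τ : PGL(2, k), ∃ a' b' d' : k, ∃ h' : a' * d' - b' * 0 ≠ 0,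
      pgl a b c d h * τ = τ * pgl a' b' 0 d' h' := by
    by_cases hc : c = 0
    · subst hc
      exact ⟨1, a, b, d, h, by simp⟩
    · obtain ⟨x, hx⟩ : ∃ x : k, c * (x * x) + (d - a) * x + -b = 0 := by
        have hdeg : (Polynomial.C c * Polynomial.X ^ 2 + Polynomial.C (d - a) * Polynomial.X +
            Polynomial.C (-b)).degree ≠ 0 := by
          rw [Polynomial.degree_quadratic hc]
          decide
        obtain ⟨x, hx⟩ := IsAlgClosed.exists_root _ hdeg
        refine ⟨x, ?_⟩
        simpa [Polynomial.IsRoot, pow_two] using hx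
      -- The root x is a finite fixed point of σ, and (x, 1; 1, 0) sends ∞ to x, so the conjugate
      -- fixes ∞.
      refine ⟨pgl x 1 1 0 (by simp), c * x + d, c, a - c * x, ?_, ?_⟩
      · intro h0
        apply h
        linear_combination h0 + c * hx
      · rw [pgl_mul, pgl_mul]
        refine pgl_congr ?_ ?_ ?_ ?_ <;> first | ring1 | linear_combination -hx
  obtain ⟨τ, a', b', d', h', hτ⟩ := upper
  have ha : a' ≠ 0 := by rintro rfl; simp at h'
  have hd : d' ≠ 0 := by rintro rfl; simp at h'
  suffices H : ∃ ρ : PGL(2, k), (∃ u : kˣ, pgl a' b' 0 d' h' * ρ = ρ * pglDiag u) ∨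
      pgl a' b' 0 d' h' * ρ = ρ * pgl 1 1 0 1 (by simp) by
    obtain ⟨ρ, hρ⟩ := H
    refine ⟨τ * ρ, ?_⟩
    rw [← mul_assoc, hτ]
    refine hρ.imp ?_ ?_
    · rintro ⟨u, hu⟩
      exact ⟨u, by rw [mul_assoc, hu, mul_assoc]⟩
    · intro hu
      rw [mul_assoc, hu, mul_assoc]
  by_cases had : a' = d'
  · subst had
    by_cases hb : b' = 0
    · subst hb
      refine ⟨1, Or.inl ⟨1, ?_⟩⟩
      rw [map_one, mul_one, mul_one, pgl_eq_one_iff]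
      simp
    -- Scaling by b'/a' turns z ↦ z + b'/a' into z ↦ z + 1.
    · refine ⟨pgl b' 0 0 a' (by simp [hb, ha]), Or.inr ?_⟩
      rw [pgl_mul, pgl_mul, pgl_eq_iff]
      refine ⟨a'⁻¹, inv_ne_zero ha, ?_, ?_, ?_, ?_⟩ <;> field_simp <;> ring
  · have had' : d' - a' ≠ 0 := sub_ne_zero.2 (Ne.symm had)
    -- The columns are eigenvectors: (1, 0) for a' and (b', d' - a') for d'.
    refine ⟨pgl 1 b' 0 (d' - a') (by simpa using had'), Or.inl ⟨Units.mk0 (a' / d')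
      (div_ne_zero ha hd), ?_⟩⟩
    rw [pglDiag_apply, pgl_mul, pgl_mul, pgl_eq_iff]
    refine ⟨d'⁻¹, inv_ne_zero hd, ?_, ?_, ?_, ?_⟩ <;> simp <;> field_simp <;> ring1

end PGL

/-! ### Linear substitutions in cubic forms -/

section Substitution

variable {k : Type*} [Field k]

/-- The coefficients of the cubic form obtained by substituting `(a x + b y, c x + d y)`. -/
def cubicSubst (p : Fin 4 → k) (a b c d : k) : Fin 4 → k :=
  ![p 0 * a ^ 3 + p 1 * a ^ 2 * c + p 2 * a * c ^ 2 + p 3 * c ^ 3,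
    p 0 * (3 * a ^ 2 * b) + p 1 * (a ^ 2 * d + 2 * a * b * c) + p 2 * (2 * a * c * d + b * c ^ 2) +
      p 3 * (3 * c ^ 2 * d),
    p 0 * (3 * a * b ^ 2) + p 1 * (2 * a * b * d + b ^ 2 * c) + p 2 * (a * d ^ 2 + 2 * b * c * d) +
      p 3 * (3 * c * d ^ 2),
    p 0 * b ^ 3 + p 1 * b ^ 2 * d + p 2 * b * d ^ 2 + p 3 * d ^ 3]

theorem cubicValue_cubicSubst (p : Fin 4 → k) (a b c d x y : k) :
    cubicValue (cubicSubst p a b c d) x y = cubicValue p (a * x + b * y) (c * x + d * y) := by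
  simp [cubicValue, cubicSubst]
  ring

theorem cubicSubst_smul (p : Fin 4 → k) (u a b c d : k) :
    cubicSubst p (u * a) (u * b) (u * c) (u * d) = u ^ 3 • cubicSubst p a b c d := by
  ext i
  fin_cases i <;> simp [cubicSubst] <;> ring

theorem cubicValue_comb (r s : k) (p q : Fin 4 → k) (x y : k) :
    cubicValue (r • p + s • q) x y = r * cubicValue p x y + s * cubicValue q x y := by
  simp [cubicValue]
  ring

theorem linear_subst_ne_zero {a b c d x y : k} (h : a * d - b * c ≠ 0) (hxy : x ≠ 0 ∨ y ≠ 0) :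
    a * x + b * y ≠ 0 ∨ c * x + d * y ≠ 0 := by
  by_contra! h0
  have hx : (a * d - b * c) * x = 0 := by linear_combination d * h0.1 - b * h0.2
  have hy : (a * d - b * c) * y = 0 := by linear_combination a * h0.2 - c * h0.1
  rcases hxy with h1 | h1
  · exact (mul_ne_zero h h1) hx
  · exact (mul_ne_zero h h1) hy

end Substitution

/-! ### Conjugacy as identities between coefficients -/

namespace RationalFunction

variable {k : Type*} [Field k]

/-- `φ` is given by the cubic forms with coefficients `p` and `q`. -/
structure HasCoeffs (φ : RationalFunction k 3) (p q : Fin 4 → k) : Prop where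
  f₀_eq : φ.f₀ = binaryCubic p
  f₁_eq : φ.f₁ = binaryCubic q

theorem exists_hasCoeffs (φ : RationalFunction k 3) : ∃ p q, φ.HasCoeffs p q := by
  obtain ⟨p, hp⟩ := exists_eq_binaryCubic φ.homogeneous₀
  obtain ⟨q, hq⟩ := exists_eq_binaryCubic φ.homogeneous₁
  exact ⟨p, q, hp, hq⟩

theorem HasCoeffs.evalVec_eq {φ : RationalFunction k 3} {p q : Fin 4 → k} (h : φ.HasCoeffs p q)
    (v : Fin 2 → k) : φ.evalVec v = ![cubicValue p (v 0) (v 1), cubicValue q (v 0) (v 1)] := by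
  rw [evalVec, h.f₀_eq, h.f₁_eq, eval_binaryCubic, eval_binaryCubic]

theorem HasCoeffs.no_common_root {φ : RationalFunction k 3} {p q : Fin 4 → k}
    (h : φ.HasCoeffs p q) (x y : k) (hxy : x ≠ 0 ∨ y ≠ 0) :
    ¬ (cubicValue p x y = 0 ∧ cubicValue q x y = 0) := by
  have := φ.noCommonRoot ![x, y] (by
    intro h0
    have h1 := congrFun h0 0
    have h2 := congrFun h0 1
    simp at h1 h2
    tauto)
  simpa [h.f₀_eq, h.f₁_eq, eval_binaryCubic] using this

theorem exists_of_coeffs {p q : Fin 4 → k}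
    (h : ∀ x y, (x ≠ 0 ∨ y ≠ 0) → ¬ (cubicValue p x y = 0 ∧ cubicValue q x y = 0)) :
    ∃ φ : RationalFunction k 3, φ.HasCoeffs p q := by
  refine ⟨⟨binaryCubic p, binaryCubic q, isHomogeneous_binaryCubic p, isHomogeneous_binaryCubic q,
    ?_⟩, rfl, rfl⟩
  intro v hv
  rw [eval_binaryCubic, eval_binaryCubic]
  refine h _ _ ?_
  by_contra! h0
  apply hv
  ext i
  fin_cases i
  exacts [h0.1, h0.2]

/-- `φ ∘ σ = σ ∘ ψ`. -/
def Intertwines (φ ψ : RationalFunction k 3) (σ : PGL(2, k)) : Prop :=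
  ∀ p : ℙ k (Fin 2 → k), φ.toMap (σ • p) = σ • ψ.toMap p

theorem mem_aut_iff {φ : RationalFunction k 3} {σ : PGL(2, k)} :
    σ ∈ φ.Aut ↔ φ.Intertwines φ σ := Iff.rfl

theorem isConj_iff {φ ψ : RationalFunction k 3} : φ.IsConj ψ ↔ ∃ σ, φ.Intertwines ψ σ := by
  refine exists_congr fun σ => forall_congr' fun p => ?_
  rw [eq_inv_smul_iff, eq_comm]

theorem Intertwines.mul {φ ψ χ : RationalFunction k 3} {σ τ : PGL(2, k)}
    (h : φ.Intertwines ψ σ) (h' : ψ.Intertwines χ τ) : φ.Intertwines χ (σ * τ) := fun p => by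
  rw [mul_smul, mul_smul, h, h']

theorem Intertwines.inv {φ ψ : RationalFunction k 3} {σ : PGL(2, k)}
    (h : φ.Intertwines ψ σ) : ψ.Intertwines φ σ⁻¹ := fun p => by
  have h := h (σ⁻¹ • p)
  rw [smul_inv_smul] at h
  rw [h, inv_smul_smul]

theorem Intertwines.mem_aut_iff {φ ψ : RationalFunction k 3} {τ σ : PGL(2, k)}
    (h : φ.Intertwines ψ τ) : σ ∈ ψ.Aut ↔ τ * σ * τ⁻¹ ∈ φ.Aut := by
  constructor
  · intro hσ
    exact (h.mul hσ).mul h.inv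
  · intro hσ
    have := (h.inv.mul hσ).mul h
    rwa [show τ⁻¹ * (τ * σ * τ⁻¹) * τ = σ by simp [mul_assoc]] at this

/-- Conjugate rational functions have isomorphic automorphism groups. -/
noncomputable def Intertwines.autEquiv {φ ψ : RationalFunction k 3} {τ : PGL(2, k)}
    (h : φ.Intertwines ψ τ) : φ.Aut ≃* ψ.Aut where
  toFun σ := ⟨τ⁻¹ * σ * τ, h.mem_aut_iff.2 (by simp [mul_assoc])⟩
  invFun σ := ⟨τ * σ * τ⁻¹, h.mem_aut_iff.1 σ.2⟩
  left_inv σ := by simp [mul_assoc]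
  right_inv σ := by simp [mul_assoc]
  map_mul' σ ρ := by simp [mul_assoc]

theorem IsConj.refl (φ : RationalFunction k 3) : φ.IsConj φ :=
  isConj_iff.2 ⟨1, fun p => by simp⟩

theorem IsConj.symm {φ ψ : RationalFunction k 3} (h : φ.IsConj ψ) : ψ.IsConj φ := by
  obtain ⟨σ, hσ⟩ := isConj_iff.1 h
  exact isConj_iff.2 ⟨_, hσ.inv⟩

theorem IsConj.trans {φ ψ χ : RationalFunction k 3} (h : φ.IsConj ψ) (h' : ψ.IsConj χ) :
    φ.IsConj χ := by
  obtain ⟨σ, hσ⟩ := isConj_iff.1 h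
  obtain ⟨τ, hτ⟩ := isConj_iff.1 h'
  exact isConj_iff.2 ⟨_, hσ.mul hτ⟩

/-- The coefficient identities expressing `φ ∘ σ = σ ∘ ψ` for the matrix `(a, b; c, d)` of `σ`, up
to a scalar `e`. -/
structure Twist (p q p' q' : Fin 4 → k) (a b c d e : k) : Prop where
  fst : cubicSubst p a b c d = e • (a • p' + b • q')
  snd : cubicSubst q a b c d = e • (c • p' + d • q')

theorem Twist.intertwines {φ ψ : RationalFunction k 3} {p q p' q' : Fin 4 → k} {a b c d e : k}
    (hφ : φ.HasCoeffs p q) (hψ : ψ.HasCoeffs p' q') (H : Twist p q p' q' a b c d e)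
    (h : a * d - b * c ≠ 0) : φ.Intertwines ψ (pgl a b c d h) := by
  intro P
  induction P using Projectivization.ind with | _ v hv =>
  obtain ⟨hw, h1⟩ := pgl_smul_mk h hv
  obtain ⟨hw', h2⟩ := pgl_smul_mk h (ψ.evalVec_ne_zero hv)
  rw [h1]
  change Projectivization.mk k _ (φ.evalVec_ne_zero hw) =
    pgl a b c d h • Projectivization.mk k _ (ψ.evalVec_ne_zero hv)
  rw [h2, Projectivization.mk_eq_mk_iff']
  refine ⟨e, ?_⟩
  rw [hφ.evalVec_eq]
  simp only [hψ.evalVec_eq, Matrix.cons_val_zero, Matrix.cons_val_one, ← cubicValue_cubicSubst,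
    H.fst, H.snd, cubicValue_smul, cubicValue_comb]
  ext i
  fin_cases i <;> simp

/-- Equality of the two maps at every point only says that the pairs of forms are pointwise
proportional. The pair for σ ∘ ψ has no common root because σ is invertible, so
`exists_smul_of_proportional` supplies one scalar for all points. -/
theorem Intertwines.exists_twist [IsAlgClosed k] [CharZero k] {φ ψ : RationalFunction k 3}
    {p q p' q' : Fin 4 → k} {a b c d : k} (hφ : φ.HasCoeffs p q) (hψ : ψ.HasCoeffs p' q')
    {h : a * d - b * c ≠ 0} (H : φ.Intertwines ψ (pgl a b c d h)) :
    ∃ e, e ≠ 0 ∧ Twist p q p' q' a b c d e := by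
  obtain ⟨e, h1, h2⟩ := exists_smul_of_proportional (p := a • p' + b • q') (q := c • p' + d • q')
    (p' := cubicSubst p a b c d) (q' := cubicSubst q a b c d) (by
      intro x y hxy h0
      rw [cubicValue_comb, cubicValue_comb] at h0
      have := linear_subst_ne_zero (x := cubicValue p' x y) (y := cubicValue q' x y) h (by
        have := hψ.no_common_root x y hxy
        tauto)
      tauto) (by
      intro x y
      by_cases hxy : x ≠ 0 ∨ y ≠ 0
      · have hv : ![x, y] ≠ 0 := by
          intro h0
          have h1 := congrFun h0 0
          have h2 := congrFun h0 1
          simp at h1 h2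
          tauto
        obtain ⟨hw, h1⟩ := pgl_smul_mk h hv
        obtain ⟨hw', h2⟩ := pgl_smul_mk h (ψ.evalVec_ne_zero hv)
        have := H (Projectivization.mk k _ hv)
        rw [h1] at this
        change Projectivization.mk k _ (φ.evalVec_ne_zero hw) =
          pgl a b c d h • Projectivization.mk k _ (ψ.evalVec_ne_zero hv) at this
        rw [h2, Projectivization.mk_eq_mk_iff'] at this
        obtain ⟨e, he⟩ := this
        have e0 := congrFun he 0
        have e1 := congrFun he 1
        simp [hφ.evalVec_eq, hψ.evalVec_eq] at e0 e1
        rw [cubicValue_comb, cubicValue_comb, cubicValue_cubicSubst, cubicValue_cubicSubst,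
          ← e0, ← e1]
        ring
      · push Not at hxy
        simp [hxy.1, hxy.2, cubicValue])
  refine ⟨e, ?_, h1, h2⟩
  rintro rfl
  rw [zero_smul] at h1 h2
  -- If the scalar were zero, both substituted forms would vanish identically, and σ(d, -c) = (ad -
  -- bc, 0) would be a common root of φ.
  have key := hφ.no_common_root (a * d + b * (-c)) (c * d + d * (-c))
    (linear_subst_ne_zero h (by by_contra! h0; apply h; rw [h0.1, neg_eq_zero.1 h0.2]; ring))
  rw [← cubicValue_cubicSubst, ← cubicValue_cubicSubst, h1, h2] at key
  simp [cubicValue] at key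

/-- Over an algebraically closed field the scalar may be taken to be one. -/
theorem Intertwines.exists_normalized_twist [IsAlgClosed k] [CharZero k]
    {φ ψ : RationalFunction k 3} {p q p' q' : Fin 4 → k} {σ : PGL(2, k)}
    (hφ : φ.HasCoeffs p q) (hψ : ψ.HasCoeffs p' q') (H : φ.Intertwines ψ σ) :
    ∃ a b c d, ∃ h : a * d - b * c ≠ 0, σ = pgl a b c d h ∧ Twist p q p' q' a b c d 1 := by
  obtain ⟨a, b, c, d, h, rfl⟩ := exists_eq_pgl σ
  obtain ⟨e, he, H1, H2⟩ := H.exists_twist hφ hψ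
  -- Scaling the matrix by u multiplies the substituted cubic by u³ and the other side by u, so u² =
  -- e⁻¹ absorbs the scalar.
  obtain ⟨u, hu⟩ := IsAlgClosed.exists_pow_nat_eq e⁻¹ (n := 2) (by norm_num)
  have hu0 : u ≠ 0 := by
    rintro rfl
    simp at hu
    exact he hu.symm
  refine ⟨u * a, u * b, u * c, u * d, ?_, pgl_eq_iff.2 ⟨u, hu0, rfl, rfl, rfl, rfl⟩, ?_, ?_⟩
  · convert mul_ne_zero (pow_ne_zero 2 hu0) h using 1
    ring
  · have : u ^ 3 * e = u := by rw [pow_succ, hu]; field_simp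
    rw [cubicSubst_smul, H1, smul_smul, this, one_smul, smul_add, smul_smul, smul_smul]
  · have : u ^ 3 * e = u := by rw [pow_succ, hu]; field_simp
    rw [cubicSubst_smul, H2, smul_smul, this, one_smul, smul_add, smul_smul, smul_smul]

/-- The forms of σ⁻¹ ∘ φ ∘ σ are written with the adjugate of σ instead of the inverse; this is why
the scalar is the inverse determinant. -/
theorem exists_intertwines (φ : RationalFunction k 3) (σ : PGL(2, k)) :
    ∃ ψ : RationalFunction k 3, φ.Intertwines ψ σ := by
  obtain ⟨a, b, c, d, h, rfl⟩ := exists_eq_pgl σ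
  obtain ⟨p, q, hφ⟩ := φ.exists_hasCoeffs
  obtain ⟨ψ, hψ⟩ := exists_of_coeffs
    (p := d • cubicSubst p a b c d + (-b) • cubicSubst q a b c d)
    (q := (-c) • cubicSubst p a b c d + a • cubicSubst q a b c d) (by
      intro x y hxy h0
      rw [cubicValue_comb, cubicValue_comb] at h0
      have h1 : (a * d - b * c) * cubicValue (cubicSubst p a b c d) x y = 0 := by
        linear_combination a * h0.1 + b * h0.2
      have h2 : (a * d - b * c) * cubicValue (cubicSubst q a b c d) x y = 0 := by
        linear_combination c * h0.1 + d * h0.2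
      rw [mul_eq_zero_iff_left h, cubicValue_cubicSubst] at h1 h2
      exact hφ.no_common_root _ _ (linear_subst_ne_zero h hxy) ⟨h1, h2⟩)
  refine ⟨ψ, Twist.intertwines (e := (a * d - b * c)⁻¹) hφ hψ ⟨?_, ?_⟩ h⟩
  all_goals
    ext i
    simp only [Pi.smul_apply, Pi.add_apply, smul_eq_mul]
    field_simp
    ring

theorem isConjToCubic_iff {φ : RationalFunction k 3} {p q : Fin 4 → k} :
    φ.IsConjToCubic p q ↔ ∃ ψ, ψ.HasCoeffs p q ∧ φ.IsConj ψ :=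
  ⟨fun ⟨ψ, h0, h1, h2⟩ => ⟨ψ, ⟨h0, h1⟩, h2⟩, fun ⟨ψ, h, h2⟩ => ⟨ψ, h.f₀_eq, h.f₁_eq, h2⟩⟩

theorem IsConj.isConjToCubic {φ ψ : RationalFunction k 3} {p q : Fin 4 → k} (h : φ.IsConj ψ)
    (h' : ψ.IsConjToCubic p q) : φ.IsConjToCubic p q := by
  obtain ⟨χ, h0, h1⟩ := isConjToCubic_iff.1 h'
  exact isConjToCubic_iff.2 ⟨χ, h0, h.trans h1⟩

/-- A coefficient identity gives a conjugacy. -/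
theorem HasCoeffs.isConjToCubic {φ : RationalFunction k 3} {p q p' q' : Fin 4 → k}
    (hφ : φ.HasCoeffs p q) {a b c d e : k} (h : a * d - b * c ≠ 0)
    (H : Twist p q p' q' a b c d e) : φ.IsConjToCubic p' q' := by
  have hnr : ∀ x y, (x ≠ 0 ∨ y ≠ 0) → ¬ (cubicValue p' x y = 0 ∧ cubicValue q' x y = 0) := by
    intro x y hxy h0
    refine hφ.no_common_root _ _ (linear_subst_ne_zero h hxy) ?_
    rw [← cubicValue_cubicSubst, ← cubicValue_cubicSubst, H.fst, H.snd]
    simp [cubicValue_smul, cubicValue_comb, h0.1, h0.2]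
  obtain ⟨ψ, hψ⟩ := exists_of_coeffs hnr
  exact isConjToCubic_iff.2 ⟨ψ, hψ, isConj_iff.2 ⟨_, H.intertwines hφ hψ h⟩⟩

end RationalFunction

/-! ### Automorphisms are diagonalizable of order at most four -/

namespace RationalFunction

variable {k : Type*} [Field k]

theorem orderOf_conj_pglDiag (τ : PGL(2, k)) (u : kˣ) :
    orderOf (τ * pglDiag u * τ⁻¹) = orderOf u := by
  rw [← MulAut.conj_apply, MulEquiv.orderOf_eq,
    orderOf_injective _ pglDiag_injective]

theorem HasCoeffs.infinity {φ : RationalFunction k 3} {p q : Fin 4 → k} (h : φ.HasCoeffs p q) :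
    p 0 ≠ 0 ∨ q 0 ≠ 0 := by
  have := h.no_common_root 1 0 (by simp)
  simp [cubicValue] at this
  tauto

theorem HasCoeffs.origin {φ : RationalFunction k 3} {p q : Fin 4 → k} (h : φ.HasCoeffs p q) :
    p 3 ≠ 0 ∨ q 3 ≠ 0 := by
  have := h.no_common_root 0 1 (by simp)
  simp [cubicValue] at this
  tauto

variable [CharZero k]

theorem orderOf_unit_of_neg_one {u : kˣ} (h : (u : k) = -1) : orderOf u = 2 := by
  apply orderOf_eq_prime
  · ext; simp [h]
  · intro h1
    rw [h1, Units.val_one] at h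
    have : (2 : k) = 0 := by linear_combination h
    exact two_ne_zero this

theorem orderOf_unit_of_cube {u : kˣ} (h : (u : k) ^ 2 + u + 1 = 0) : orderOf u = 3 := by
  apply orderOf_eq_prime
  · ext
    rw [Units.val_pow_eq_pow_val, Units.val_one]
    linear_combination ((u : k) - 1) * h
  · intro h1
    rw [h1, Units.val_one] at h
    have : (3 : k) = 0 := by linear_combination h
    exact three_ne_zero this

theorem orderOf_unit_of_sq {u : kˣ} (h : (u : k) ^ 2 = -1) : orderOf u = 4 := by
  apply orderOf_eq_prime_pow (p := 2) (n := 1)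
  · intro h1
    have := congrArg Units.val h1
    simp [h] at this
    have h2 : (2 : k) = 0 := by linear_combination -this
    exact two_ne_zero h2
  · ext
    simp only [Units.val_pow_eq_pow_val, Units.val_one]
    linear_combination ((u : k) ^ 2 - 1) * h

variable [IsAlgClosed k]

/-- In the affine coordinate, q(z + 1) = e q(z) and p(z + 1) = e (p(z) + q(z)). If e ≠ 1, the
leading coefficients of both vanish. If e = 1, q is periodic, hence constant in characteristic 0,
and then p is at most linear. Either way ∞ would be a common root. -/
theorem translation_notMem_aut (φ : RationalFunction k 3) : pgl 1 1 0 1 (by simp) ∉ φ.Aut := by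
  intro H
  obtain ⟨p, q, h⟩ := φ.exists_hasCoeffs
  obtain ⟨e, he, H1, H2⟩ := Intertwines.exists_twist h h H
  have a0 := congrFun H1 0
  have a1 := congrFun H1 1
  have b0 := congrFun H2 0
  have b1 := congrFun H2 1
  have b2 := congrFun H2 2
  have b3 := congrFun H2 3
  simp [cubicSubst] at a0 a1 b0 b1 b2 b3
  by_cases he1 : e = 1
  · subst he1
    have hq : q 0 = 0 := by linear_combination b1 / 3
    have hq1 : q 1 = 0 := by linear_combination b2 / 2 - 3 * hq / 2
    have hp : p 0 = 0 := by linear_combination a1 / 3 + hq1 / 3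
    exact h.infinity.elim (· hp) (· hq)
  · have he1' : e - 1 ≠ 0 := sub_ne_zero.2 he1
    have hq : q 0 = 0 := by
      rw [← mul_eq_zero_iff_left he1']; linear_combination -b0
    have hp : p 0 = 0 := by
      rw [← mul_eq_zero_iff_left he1']; linear_combination -a0 - e * hq
    exact h.infinity.elim (· hp) (· hq)

theorem exists_diag_of_mem_aut {φ : RationalFunction k 3} {σ : PGL(2, k)} (hσ : σ ∈ φ.Aut) :
    ∃ τ ψ, ∃ u : kˣ, φ.Intertwines ψ τ ∧ σ = τ * pglDiag u * τ⁻¹ ∧ pglDiag u ∈ ψ.Aut := by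
  obtain ⟨τ, h⟩ := exists_conj_diag_or_translation σ
  obtain ⟨ψ, hψ⟩ := φ.exists_intertwines τ
  rcases h with ⟨u, hu⟩ | hu
  · have hu' := eq_mul_inv_of_mul_eq hu
    exact ⟨τ, ψ, u, hψ, hu', by rwa [hψ.mem_aut_iff, ← hu']⟩
  · have hu' := eq_mul_inv_of_mul_eq hu
    rw [hu', ← hψ.mem_aut_iff] at hσ
    exact (ψ.translation_notMem_aut hσ).elim

/-- A nonzero coefficient p i forces e = u^(2 - i), and a nonzero q i forces e = u^(3 - i). The
points ∞ and 0 give a nonzero coefficient of index 0 and one of index 3, each in p or in q. The four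
combinations give u³ = 1, u² = 1, u⁴ = 1 and u³ = 1, and any coefficient asking for another power of
u must vanish. -/
theorem coeffs_of_diag_mem_aut {ψ : RationalFunction k 3} {p q : Fin 4 → k}
    (h : ψ.HasCoeffs p q) {u : kˣ} (hu : u ≠ 1) (H : pglDiag u ∈ ψ.Aut) :
    ((u : k) = -1 ∧ p = ![p 0, 0, p 2, 0] ∧ q = ![0, q 1, 0, q 3] ∧ p 0 ≠ 0 ∧ q 3 ≠ 0) ∨
    ((u : k) = -1 ∧ p = ![0, p 1, 0, p 3] ∧ q = ![q 0, 0, q 2, 0] ∧ p 3 ≠ 0 ∧ q 0 ≠ 0) ∨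
    ((u : k) ^ 2 + u + 1 = 0 ∧ p = ![p 0, 0, 0, p 3] ∧ q = ![0, q 1, 0, 0] ∧
      p 0 ≠ 0 ∧ p 3 ≠ 0 ∧ q 1 ≠ 0) ∨
    ((u : k) ^ 2 + u + 1 = 0 ∧ p = ![0, 0, p 2, 0] ∧ q = ![q 0, 0, 0, q 3] ∧
      q 0 ≠ 0 ∧ q 3 ≠ 0 ∧ p 2 ≠ 0) ∨
    ((u : k) ^ 2 = -1 ∧ p = ![0, 0, 0, p 3] ∧ q = ![q 0, 0, 0, 0] ∧ p 3 ≠ 0 ∧ q 0 ≠ 0) := by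
  rw [pglDiag_apply] at H
  obtain ⟨e, he, H1, H2⟩ := Intertwines.exists_twist h h H
  have hv : (u : k) ≠ 0 := u.ne_zero
  have hv1 : (u : k) ≠ 1 := fun h => hu (Units.ext h)
  have hw : (u : k) - 1 ≠ 0 := sub_ne_zero.2 hv1
  clear H hu
  generalize (u : k) = v at *
  have a0 := congrFun H1 0
  have a1 := congrFun H1 1
  have a2 := congrFun H1 2
  have a3 := congrFun H1 3
  have b0 := congrFun H2 0
  have b1 := congrFun H2 1
  have b2 := congrFun H2 2
  have b3 := congrFun H2 3
  simp [cubicSubst] at a0 a1 a2 a3 b0 b1 b2 b3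
  have ext4 : ∀ {r : Fin 4 → k} {x y z w : k}, r 0 = x → r 1 = y → r 2 = z → r 3 = w →
      r = ![x, y, z, w] := by
    rintro r x y z w rfl rfl rfl rfl
    ext i
    fin_cases i <;> rfl
  have A0 : p 0 ≠ 0 → e = v ^ 2 := fun hp => by
    apply mul_left_cancel₀ (mul_ne_zero hp hv); linear_combination -a0
  have A1 : p 1 ≠ 0 → e = v := fun hp => by
    apply mul_left_cancel₀ (mul_ne_zero hp hv); linear_combination -a1
  have A2 : p 2 ≠ 0 → e = 1 := fun hp => by
    apply mul_left_cancel₀ (mul_ne_zero hp hv); linear_combination -a2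
  have A3 : p 3 ≠ 0 → e * v = 1 := fun hp => by
    apply mul_left_cancel₀ hp; linear_combination -a3
  have B0 : q 0 ≠ 0 → e = v ^ 3 := fun hp => by
    apply mul_left_cancel₀ hp; linear_combination -b0
  have B1 : q 1 ≠ 0 → e = v ^ 2 := fun hp => by
    apply mul_left_cancel₀ hp; linear_combination -b1
  have B2 : q 2 ≠ 0 → e = v := fun hp => by
    apply mul_left_cancel₀ hp; linear_combination -b2
  have B3 : q 3 ≠ 0 → e = 1 := fun hp => by
    apply mul_left_cancel₀ hp; linear_combination -b3
  clear a0 a1 a2 a3 b0 b1 b2 b3 H1 H2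
  have cancel : ∀ {x : k}, x * (v - 1) = 0 → x = 0 := fun hx =>
    (mul_eq_zero.1 hx).resolve_right hw
  -- consequences of equalities between distinct powers
  have v12 : v ≠ v ^ 2 := fun h => mul_ne_zero hv hw (by linear_combination -h)
  have v01 : (1 : k) ≠ v := fun h => hv1 h.symm
  have v23 : v ^ 2 ≠ v ^ 3 := fun h => mul_ne_zero (pow_ne_zero 2 hv) hw (by linear_combination -h)
  have v_1 : v ^ 2 = 1 → v = -1 := fun h => by
    have := cancel (x := v + 1) (by linear_combination h)
    linear_combination this
  have v_3 : v ^ 3 = 1 → v ^ 2 + v + 1 = 0 := fun h => cancel (by linear_combination h)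
  have v_4 : v ^ 4 = 1 → v = -1 ∨ v ^ 2 = -1 := fun h => by
    have : (v + 1) * (v ^ 2 + 1) = 0 := cancel (by linear_combination h)
    rcases mul_eq_zero.1 this with h | h
    · exact Or.inl (by linear_combination h)
    · exact Or.inr (by linear_combination h)
  rcases h.infinity with h0 | h0 <;> rcases h.origin with h3 | h3
  · have e0 := A0 h0
    subst e0
    have hv3 : v ^ 3 = 1 := by linear_combination A3 h3
    have hne : v ^ 2 ≠ 1 := fun h => hv1 (by linear_combination hv3 - v * h)
    have p1 : p 1 = 0 := by by_contra hp; exact v12 (A1 hp).symm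
    have p2 : p 2 = 0 := by by_contra hp; exact hne (A2 hp)
    have q0 : q 0 = 0 := by by_contra hp; exact v23 (B0 hp)
    have q2 : q 2 = 0 := by by_contra hp; exact v12 (B2 hp).symm
    have q3 : q 3 = 0 := by by_contra hp; exact hne (B3 hp)
    refine Or.inr (Or.inr (Or.inl ⟨v_3 hv3, ext4 rfl p1 p2 rfl, ext4 q0 rfl q2 q3, h0, h3, ?_⟩))
    -- If this coefficient vanished too, the second form would be zero and any root of the first
    -- would be a common root.
    intro q1
    obtain ⟨z, hz⟩ := IsAlgClosed.exists_pow_nat_eq (-p 3 / p 0) (n := 3) (by norm_num)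
    apply h.no_common_root z 1 (by simp)
    simp [cubicValue, p1, p2, q0, q1, q2, q3, hz]
    field_simp
    ring
  · have e0 := A0 h0
    subst e0
    have hv2 : v ^ 2 = 1 := B3 h3
    have hv' := v_1 hv2
    have p1 : p 1 = 0 := by by_contra hp; exact v12 (A1 hp).symm
    have p3 : p 3 = 0 := by by_contra hp; exact hv1 (by linear_combination A3 hp - v * hv2)
    have q0 : q 0 = 0 := by by_contra hp; exact v23 (B0 hp)
    have q2 : q 2 = 0 := by by_contra hp; exact v12 (B2 hp).symm
    exact Or.inl ⟨hv', ext4 rfl p1 rfl p3, ext4 q0 rfl q2 rfl, h0, h3⟩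
  · have e0 := B0 h0
    subst e0
    have hv4 : v ^ 4 = 1 := by linear_combination A3 h3
    have p0 : p 0 = 0 := by by_contra hp; exact v23 (A0 hp).symm
    have p2 : p 2 = 0 := by
      by_contra hp; exact hv1 (by linear_combination hv4 - v * A2 hp)
    have q1 : q 1 = 0 := by by_contra hp; exact v23 (B1 hp).symm
    have q3 : q 3 = 0 := by
      by_contra hp; exact hv1 (by linear_combination hv4 - v * B3 hp)
    rcases v_4 hv4 with hv' | hv'
    · exact Or.inr (Or.inl ⟨hv', ext4 p0 rfl p2 rfl, ext4 rfl q1 rfl q3, h3, h0⟩)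
    · have hne : v ^ 3 ≠ v := fun h => by
        have h' : (-2 : k) * v = 0 := by linear_combination h - v * hv'
        simp [hv] at h'
      have p1 : p 1 = 0 := by by_contra hp; exact hne (A1 hp)
      have q2 : q 2 = 0 := by by_contra hp; exact hne (B2 hp)
      exact Or.inr (Or.inr (Or.inr (Or.inr ⟨hv', ext4 p0 p1 p2 rfl, ext4 rfl q1 q2 q3, h3, h0⟩)))
  · have e0 := B0 h0
    subst e0
    have hv3 : v ^ 3 = 1 := B3 h3
    have p0 : p 0 = 0 := by by_contra hp; exact v23 (A0 hp).symm
    have p1 : p 1 = 0 := by by_contra hp; exact v01 (hv3.symm.trans (A1 hp))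
    have p3 : p 3 = 0 := by by_contra hp; exact hv1 (by linear_combination A3 hp - v * hv3)
    have q1 : q 1 = 0 := by by_contra hp; exact v23 (B1 hp).symm
    have q2 : q 2 = 0 := by by_contra hp; exact v01 (hv3.symm.trans (B2 hp))
    refine Or.inr (Or.inr (Or.inr (Or.inl
      ⟨v_3 hv3, ext4 p0 p1 rfl p3, ext4 rfl q1 q2 rfl, h0, h3, ?_⟩)))
    intro p2
    obtain ⟨z, hz⟩ := IsAlgClosed.exists_pow_nat_eq (-q 3 / q 0) (n := 3) (by norm_num)
    apply h.no_common_root z 1 (by simp)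
    simp [cubicValue, p0, p1, p2, p3, q1, q2, hz]
    field_simp
    ring

end RationalFunction

/-! ### Rescaling to the normal forms -/

namespace RationalFunction

variable {k : Type*} [Field k]

/-- The involution `z ↦ -z`. -/
noncomputable def negation (k : Type*) [Field k] : PGL(2, k) := pglDiag (-1)

theorem negation_eq : negation k = pgl (-1) 0 0 1 (by simp) := by
  rw [negation, pglDiag_apply]
  exact pgl_congr (by simp) rfl rfl rfl

variable [IsAlgClosed k]

theorem IsL₁.mul_ne_one {φ : RationalFunction k 3} {t s : k} (h : φ.IsL₁ t s) : t * s ≠ 1 := by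
  obtain ⟨ψ, hψ, -⟩ := isConjToCubic_iff.1 h
  intro hts
  obtain ⟨z, hz⟩ := IsAlgClosed.exists_pow_nat_eq (-t) (n := 2) (by norm_num)
  apply hψ.no_common_root z 1 (by simp)
  simp only [cubicValue, Matrix.cons_val]
  constructor
  · linear_combination z * hz
  · linear_combination s * hz - hts

theorem IsL₂.mul_ne_one {φ : RationalFunction k 3} {t s : k} (h : φ.IsL₂ t s) : t * s ≠ 1 := by
  obtain ⟨ψ, hψ, -⟩ := isConjToCubic_iff.1 h
  intro hts
  obtain ⟨z, hz⟩ := IsAlgClosed.exists_pow_nat_eq (-t) (n := 2) (by norm_num)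
  apply hψ.no_common_root z 1 (by simp)
  simp only [cubicValue, Matrix.cons_val]
  constructor
  · linear_combination s * hz - hts
  · linear_combination z * hz

theorem IsL₄.sq_ne_one {φ : RationalFunction k 3} {t : k} (h : φ.IsL₄ t) : t ^ 2 ≠ 1 := by
  rw [pow_two]
  exact IsL₂.mul_ne_one h

theorem IsL₅.sq_ne_one {φ : RationalFunction k 3} {t : k} (h : φ.IsL₅ t) : t ^ 2 ≠ 1 := by
  obtain ⟨ψ, hψ, -⟩ := isConjToCubic_iff.1 h
  intro hts
  obtain ⟨z, hz⟩ := IsAlgClosed.exists_pow_nat_eq t (n := 2) (by norm_num)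
  apply hψ.no_common_root z 1 (by simp)
  simp only [cubicValue, Matrix.cons_val]
  constructor
  · linear_combination t * hz + hts
  · linear_combination z * hz

/-- Conjugation by z ↦ lz multiplies the coefficients by powers of l, and numerator and denominator
share one further scalar. The required power of l is the one that makes the two coefficients that
agree up to sign in the normal form do so; the following lemmas work in the same way. -/
theorem HasCoeffs.exists_isL₁ {φ : RationalFunction k 3} {a b c d : k}
    (h : φ.HasCoeffs ![a, 0, b, 0] ![0, c, 0, d]) (ha : a ≠ 0) (hd : d ≠ 0) :
    ∃ t s, φ.IsL₁ t s := by
  obtain ⟨l, hl⟩ := IsAlgClosed.exists_pow_nat_eq (d / a) (n := 2) (by norm_num)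
  have hl0 : l ≠ 0 := by
    rintro rfl
    rw [zero_pow two_ne_zero] at hl
    exact div_ne_zero hd ha hl.symm
  have hl' : a * l ^ 2 = d := by rw [hl]; field_simp
  refine ⟨b / d, c / a, h.isConjToCubic (a := l) (b := 0) (c := 0) (d := 1) (e := d)
    (by simpa using hl0) ⟨?_, ?_⟩⟩ <;> ext i <;> fin_cases i <;> simp [cubicSubst]
  · linear_combination l * hl'
  · field_simp
  · field_simp
    linear_combination c * hl'

theorem HasCoeffs.exists_isL₂ {φ : RationalFunction k 3} {a b c d : k}
    (h : φ.HasCoeffs ![0, a, 0, b] ![c, 0, d, 0]) (hb : b ≠ 0) (hc : c ≠ 0) :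
    ∃ t s, φ.IsL₂ t s := by
  obtain ⟨l, hl⟩ := IsAlgClosed.exists_pow_nat_eq (b / c) (n := 4) (by norm_num)
  have hl0 : l ≠ 0 := by
    rintro rfl
    rw [zero_pow four_ne_zero] at hl
    exact div_ne_zero hb hc hl.symm
  have hl' : c * l ^ 4 = b := by rw [hl]; field_simp
  refine ⟨d / (c * l ^ 2), a * l ^ 2 / b, h.isConjToCubic (a := l) (b := 0) (c := 0) (d := 1)
    (e := c * l ^ 3) (by simpa using hl0) ⟨?_, ?_⟩⟩ <;> ext i <;> fin_cases i <;> simp [cubicSubst]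
  · field_simp
    linear_combination -a * hl'
  · linear_combination -hl'
  · field_simp

theorem HasCoeffs.exists_isL₃ {φ : RationalFunction k 3} {a b c : k}
    (h : φ.HasCoeffs ![a, 0, 0, b] ![0, c, 0, 0]) (ha : a ≠ 0) (hb : b ≠ 0) (hc : c ≠ 0) :
    ∃ t, t ≠ 0 ∧ φ.IsL₃ t := by
  obtain ⟨l, hl⟩ := IsAlgClosed.exists_pow_nat_eq (b / c) (n := 3) (by norm_num)
  have hl0 : l ≠ 0 := by
    rintro rfl
    rw [zero_pow three_ne_zero] at hl
    exact div_ne_zero hb hc hl.symm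
  have hl' : c * l ^ 3 = b := by rw [hl]; field_simp
  refine ⟨-c / a, div_ne_zero (neg_ne_zero.2 hc) ha, h.isConjToCubic (a := l) (b := 0) (c := 0)
    (d := 1) (e := a * l ^ 2) (by simpa using hl0) ⟨?_, ?_⟩⟩ <;> ext i <;> fin_cases i <;>
    simp [cubicSubst]
  · ring
  · field_simp
    linear_combination -hl'
  · field_simp

/-- Here φ sends ∞ to 0 instead of fixing it. The change of coordinate z ↦ l/z exchanges 0 and ∞ and
leads back to the shape of L₃. -/
theorem HasCoeffs.exists_isL₃' {φ : RationalFunction k 3} {a b c : k}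
    (h : φ.HasCoeffs ![0, 0, c, 0] ![a, 0, 0, b]) (ha : a ≠ 0) (hb : b ≠ 0) (hc : c ≠ 0) :
    ∃ t, t ≠ 0 ∧ φ.IsL₃ t := by
  obtain ⟨l, hl⟩ := IsAlgClosed.exists_pow_nat_eq (c / a) (n := 3) (by norm_num)
  have hl0 : l ≠ 0 := by
    rintro rfl
    rw [zero_pow three_ne_zero] at hl
    exact div_ne_zero hc ha hl.symm
  have hl' : a * l ^ 3 = c := by rw [hl]; field_simp
  refine ⟨-c / b, div_ne_zero (neg_ne_zero.2 hc) hb, h.isConjToCubic (a := 0) (b := l) (c := 1)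
    (d := 0) (e := b) (by simpa using hl0) ⟨?_, ?_⟩⟩ <;> ext i <;> fin_cases i <;>
    simp [cubicSubst]
  · field_simp
  · field_simp
    linear_combination hl'

theorem HasCoeffs.isL₇ {φ : RationalFunction k 3} {a b : k}
    (h : φ.HasCoeffs ![0, 0, 0, a] ![b, 0, 0, 0]) (ha : a ≠ 0) (hb : b ≠ 0) : φ.IsL₇ := by
  obtain ⟨l, hl⟩ := IsAlgClosed.exists_pow_nat_eq (a / b) (n := 4) (by norm_num)
  have hl0 : l ≠ 0 := by
    rintro rfl
    rw [zero_pow four_ne_zero] at hl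
    exact div_ne_zero ha hb hl.symm
  have hl' : b * l ^ 4 = a := by rw [hl]; field_simp
  refine h.isConjToCubic (a := l) (b := 0) (c := 0)
    (d := 1) (e := b * l ^ 3) (by simpa using hl0) ⟨?_, ?_⟩ <;> ext i <;> fin_cases i <;>
    simp [cubicSubst]
  linear_combination -hl'

variable [CharZero k]

theorem orderOf_cases_of_mem_aut {φ : RationalFunction k 3} {σ : PGL(2, k)} (hσ : σ ∈ φ.Aut) :
    orderOf σ = 1 ∨ (orderOf σ = 2 ∧ ∃ t s, φ.IsL₁ t s ∨ φ.IsL₂ t s) ∨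
      (orderOf σ = 3 ∧ ∃ t, t ≠ 0 ∧ φ.IsL₃ t) ∨ (orderOf σ = 4 ∧ φ.IsL₇) := by
  obtain ⟨τ, ψ, u, hψ, rfl, hu⟩ := exists_diag_of_mem_aut hσ
  have hc := isConj_iff.2 ⟨τ, hψ⟩
  rw [orderOf_conj_pglDiag]
  by_cases hu1 : u = 1
  · exact Or.inl (by rw [hu1, orderOf_one])
  obtain ⟨p, q, h⟩ := ψ.exists_hasCoeffs
  rcases coeffs_of_diag_mem_aut h hu1 hu with ⟨hv, hp, hq, h0, h1⟩ | ⟨hv, hp, hq, h0, h1⟩ |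
    ⟨hv, hp, hq, h0, h1, h2⟩ | ⟨hv, hp, hq, h0, h1, h2⟩ | ⟨hv, hp, hq, h0, h1⟩
  · rw [hp, hq] at h
    obtain ⟨t, s, hL⟩ := h.exists_isL₁ h0 h1
    exact Or.inr (Or.inl ⟨orderOf_unit_of_neg_one hv, t, s, Or.inl (hc.isConjToCubic hL)⟩)
  · rw [hp, hq] at h
    obtain ⟨t, s, hL⟩ := h.exists_isL₂ h0 h1
    exact Or.inr (Or.inl ⟨orderOf_unit_of_neg_one hv, t, s, Or.inr (hc.isConjToCubic hL)⟩)
  · rw [hp, hq] at h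
    obtain ⟨t, ht, hL⟩ := h.exists_isL₃ h0 h1 h2
    exact Or.inr (Or.inr (Or.inl ⟨orderOf_unit_of_cube hv, t, ht, hc.isConjToCubic hL⟩))
  · rw [hp, hq] at h
    obtain ⟨t, ht, hL⟩ := h.exists_isL₃' h0 h1 h2
    exact Or.inr (Or.inr (Or.inl ⟨orderOf_unit_of_cube hv, t, ht, hc.isConjToCubic hL⟩))
  · rw [hp, hq] at h
    exact Or.inr (Or.inr (Or.inr ⟨orderOf_unit_of_sq hv, hc.isConjToCubic (h.isL₇ h0 h1)⟩))

omit [IsAlgClosed k] in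
theorem orderOf_negation : orderOf (negation k) = 2 := by
  rw [negation, orderOf_injective _ pglDiag_injective]
  exact orderOf_unit_of_neg_one (by simp)

theorem coeffs_of_negation_mem_aut {ψ : RationalFunction k 3} {p q : Fin 4 → k}
    (h : ψ.HasCoeffs p q) (H : negation k ∈ ψ.Aut) :
    (p = ![p 0, 0, p 2, 0] ∧ q = ![0, q 1, 0, q 3] ∧ p 0 ≠ 0 ∧ q 3 ≠ 0) ∨
    (p = ![0, p 1, 0, p 3] ∧ q = ![q 0, 0, q 2, 0] ∧ p 3 ≠ 0 ∧ q 0 ≠ 0) := by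
  have h1 : (-1 : kˣ) ≠ 1 := by
    intro h
    have := congrArg Units.val h
    rw [Units.val_neg, Units.val_one] at this
    exact two_ne_zero (α := k) (by linear_combination -this)
  rcases coeffs_of_diag_mem_aut h h1 H with ⟨hv, h⟩ | ⟨hv, h⟩ | ⟨hv, h⟩ | ⟨hv, h⟩ | ⟨hv, h⟩
  · exact Or.inl h
  · exact Or.inr h
  · simp at hv
  · simp at hv
  · rw [Units.val_neg, Units.val_one] at hv
    exact (two_ne_zero (α := k) (by linear_combination hv)).elim

/-- The involution `z ↦ 1 / z`. -/
noncomputable def inversion (k : Type*) [Field k] : PGL(2, k) := pgl 0 1 1 0 (by simp)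

/-- For an involution in the Klein four-group, φ either fixes or exchanges its two fixed points. If
φ exchanges 0 and ∞, the fixed points of -z, the sign e in the commutation with 1/z separates L₄
from L₅. If φ fixes 0 and ∞, it exchanges the fixed points of another involution of the group, and a
matrix normalizing the group moves that involution to -z; the result is then always L₄. -/
theorem isL₄_or_isL₅_of_mem_aut {ψ : RationalFunction k 3}
    (hn : negation k ∈ ψ.Aut) (hi : inversion k ∈ ψ.Aut) : ∃ t, ψ.IsL₄ t ∨ ψ.IsL₅ t := by
  obtain ⟨p, q, h⟩ := ψ.exists_hasCoeffs
  rw [inversion] at hi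
  rcases coeffs_of_negation_mem_aut h hn with ⟨hp, hq, h0, h1⟩ | ⟨hp, hq, h0, h1⟩
  · generalize p 0 = a at *
    generalize p 2 = b at *
    generalize q 1 = c at *
    generalize q 3 = d at *
    subst hp hq
    obtain ⟨e, he, H1, H2⟩ := Intertwines.exists_twist h h hi
    have a1 := congrFun H1 1
    have a3 := congrFun H1 3
    have b0 := congrFun H2 0
    simp [cubicSubst] at a1 a3 b0
    have hee : (e - 1) * (e + 1) = 0 := by
      apply (mul_eq_zero_iff_left h0).1
      linear_combination -a3 - e * b0
    rcases mul_eq_zero.1 hee with he | he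
    · obtain rfl : e = 1 := by linear_combination he
      obtain rfl : b = c := by linear_combination a1
      obtain rfl : a = d := by linear_combination a3
      obtain ⟨i, hi2⟩ := IsAlgClosed.exists_pow_nat_eq (-1 : k) (n := 2) (by norm_num)
      have hab : b - a ≠ 0 := by
        intro h'
        have hb : b = a := by linear_combination h'
        subst hb
        apply h.no_common_root i 1 (by simp)
        simp only [cubicValue, Matrix.cons_val]
        constructor
        · linear_combination b * i * hi2
        · linear_combination b * hi2
      -- Here φ exchanges i and -i, the fixed points of z ↦ -1/z; the matrix (1, i; i, 1) sends 0
      -- and ∞ to them.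
      refine ⟨(3 * a + b) / (b - a), Or.inl (h.isConjToCubic (a := 1) (b := i) (c := i) (d := 1)
        (e := i * (b - a)) ?_ ⟨?_, ?_⟩)⟩
      · intro h'
        exact two_ne_zero (α := k) (by linear_combination h' + hi2)
      all_goals
        ext j
        fin_cases j <;> simp [cubicSubst] <;> (try field_simp) <;> grind
    · obtain rfl : e = -1 := by linear_combination he
      obtain rfl : b = -c := by linear_combination a1
      obtain rfl : a = -d := by linear_combination a3
      have hab : d + c ≠ 0 := by
        intro h'
        have hb : c = -d := by linear_combination h'
        subst hb
        apply h.no_common_root 1 1 (by simp)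
        simp [cubicValue]
      -- Here φ exchanges 1 and -1, the fixed points of z ↦ 1/z; the matrix (1, 1; 1, -1) sends ∞
      -- and 0 to them.
      refine ⟨(3 * d - c) / (d + c), Or.inl (h.isConjToCubic (a := 1) (b := 1) (c := 1) (d := -1)
        (e := -(d + c)) ?_ ⟨?_, ?_⟩)⟩
      · norm_num
      all_goals
        ext j
        fin_cases j <;> simp [cubicSubst] <;> (try field_simp) <;> ring
  · generalize p 1 = a at *
    generalize p 3 = b at *
    generalize q 0 = c at *
    generalize q 2 = d at *
    subst hp hq
    obtain ⟨e, he, H1, H2⟩ := Intertwines.exists_twist h h hi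
    have a0 := congrFun H1 0
    have a2 := congrFun H1 2
    have b3 := congrFun H2 3
    simp [cubicSubst] at a0 a2 b3
    have hee : (e - 1) * (e + 1) = 0 := by
      apply (mul_eq_zero_iff_left h0).1
      linear_combination -a0 - e * b3
    rcases mul_eq_zero.1 hee with he | he
    · obtain rfl : e = 1 := by linear_combination he
      refine ⟨a / b, Or.inl (h.isConjToCubic (a := 1) (b := 0) (c := 0) (d := 1)
        (e := b) (by simp) ⟨?_, ?_⟩)⟩ <;> ext j <;>
        fin_cases j <;> simp [cubicSubst] <;> (try field_simp) <;> grind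
    · obtain rfl : e = -1 := by linear_combination he
      refine ⟨-a / b, Or.inr (h.isConjToCubic (a := 1) (b := 0) (c := 0) (d := 1)
        (e := -b) (by simp) ⟨?_, ?_⟩)⟩ <;> ext j <;>
        fin_cases j <;> simp [cubicSubst] <;> (try field_simp) <;> grind

end RationalFunction

/-! ### Facts about small groups -/

section Groups

/-- Two distinct commuting involutions generate a Klein four-group. -/
theorem exists_injective_of_commuting_involutions {G : Type*} [Group G] {a b : G} (ha : a ≠ 1)
    (hb : b ≠ 1) (hab : a ≠ b) (ha2 : a ^ 2 = 1) (hb2 : b ^ 2 = 1) (hc : a * b = b * a) :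
    ∃ f : Multiplicative (ZMod 2) × Multiplicative (ZMod 2) →* G, Function.Injective f := by
  have hzm : ∀ {c : G}, c ^ 2 = 1 → c ≠ 1 → ∃ g : Multiplicative (ZMod 2) →* G,
      (∀ x, x = 1 ∨ g x = c) ∧ ∀ x, g x = 1 ∨ g x = c := by
    intro c hc2 hc1
    have h1 : ∀ x : Multiplicative (ZMod 2), x = 1 ∨ x = Multiplicative.ofAdd 1 := by decide
    let g : Multiplicative (ZMod 2) →* G :=
      AddMonoidHom.toMultiplicative (ZMod.lift 2
        ⟨(zmultiplesHom (Additive G)) (Additive.ofMul c), by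
          simp only [zmultiplesHom_apply]
          rw [← ofMul_zpow]
          exact congrArg Additive.ofMul (by exact_mod_cast hc2)⟩)
    have hg : g (Multiplicative.ofAdd 1) = c := by
      change Additive.toMul (ZMod.lift 2 _ (1 : ZMod 2)) = c
      have := ZMod.lift_coe 2 (A := Additive G)
        ⟨(zmultiplesHom (Additive G)) (Additive.ofMul c), by
          simp only [zmultiplesHom_apply]
          rw [← ofMul_zpow]
          exact congrArg Additive.ofMul (by exact_mod_cast hc2)⟩ 1
      rw [Int.cast_one] at this
      rw [this]
      simp
    refine ⟨g, fun x => (h1 x).imp id fun hx => by rw [hx, hg], fun x => ?_⟩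
    rcases h1 x with rfl | rfl
    · exact Or.inl (map_one g)
    · exact Or.inr hg
  obtain ⟨g, hg, hg'⟩ := hzm ha2 ha
  obtain ⟨g', hgb, hgb'⟩ := hzm hb2 hb
  refine ⟨MonoidHom.noncommCoprod g g' ?_, ?_⟩
  · intro x y
    rcases hg' x with h | h <;> rcases hgb' y with h' | h' <;> simp only [h, h']
    exacts [Commute.one_right _, Commute.one_left _, Commute.one_right _, hc]
  · rw [injective_iff_map_eq_one]
    rintro ⟨x, y⟩ hxy
    rw [MonoidHom.noncommCoprod_apply] at hxy
    rcases hg x with rfl | h <;> rcases hgb y with rfl | h'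
    · rfl
    · simp [h', hb] at hxy
    · simp [h, ha] at hxy
    · rw [h, h'] at hxy
      have hba : b⁻¹ = b := inv_eq_of_mul_eq_one_left (by rw [← pow_two, hb2])
      exact (hab ((eq_inv_of_mul_eq_one_left hxy).trans hba)).elim

theorem exists_commuting_involutions {G : Type*} [Group G]
    {f : Multiplicative (ZMod 2) × Multiplicative (ZMod 2) →* G} (hf : Function.Injective f) :
    ∃ a b : G, a ≠ 1 ∧ b ≠ 1 ∧ a ≠ b ∧ a ^ 2 = 1 ∧ b ^ 2 = 1 ∧ a * b = b * a := by
  refine ⟨f (Multiplicative.ofAdd 1, 1), f (1, Multiplicative.ofAdd 1), ?_, ?_, ?_, ?_, ?_, ?_⟩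
  · rw [Ne, map_eq_one_iff f hf]; decide
  · rw [Ne, map_eq_one_iff f hf]; decide
  · rw [Ne, hf.eq_iff]; decide
  · rw [← map_pow, map_eq_one_iff f hf]; decide
  · rw [← map_pow, map_eq_one_iff f hf]; decide
  · rw [← map_mul, ← map_mul, mul_comm]

theorem mul_comm_of_forall_sq_eq_one {G : Type*} [Group G] (h2 : ∀ x : G, x ^ 2 = 1) (a b : G) :
    a * b = b * a := by
  have hinv : ∀ x : G, x⁻¹ = x := fun x => inv_eq_of_mul_eq_one_left (by rw [← pow_two, h2])
  rw [← hinv (a * b), mul_inv_rev, hinv, hinv]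

instance : IsKleinFour (Multiplicative (ZMod 2) × Multiplicative (ZMod 2)) where
  card_four := by simp
  exponent_two := by
    have h : ∀ x : Multiplicative (ZMod 2) × Multiplicative (ZMod 2), x ^ 2 = 1 := by decide
    refine (Nat.dvd_prime Nat.prime_two).1 (Monoid.exponent_dvd_of_forall_pow_eq_one h)
      |>.resolve_left ?_
    rw [Monoid.exp_eq_one_iff]
    intro h
    have := h.elim (Multiplicative.ofAdd 1, 1) 1
    revert this
    decide

/-- A group of exponent two in which the product of any two elements outside `{1, a}` lies in
`{1, a}` has order two or is a Klein four-group. -/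
theorem nonempty_mulEquiv_of_mul_mem {G : Type*} [Group G] {a : G} (ha : a ≠ 1)
    (h2 : ∀ x : G, x ^ 2 = 1)
    (h : ∀ x y : G, x ≠ 1 → x ≠ a → y ≠ 1 → y ≠ a → x * y = 1 ∨ x * y = a) :
    Nonempty (G ≃* Multiplicative (ZMod 2)) ∨
      Nonempty (G ≃* Multiplicative (ZMod 2) × Multiplicative (ZMod 2)) := by
  by_cases hb : ∃ b : G, b ≠ 1 ∧ b ≠ a
  · right
    obtain ⟨b, hb1, hba⟩ := hb
    have hb' : b⁻¹ = b := inv_eq_of_mul_eq_one_left (by rw [← pow_two, h2])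
    classical
    let _ : Fintype G := ⟨{1, a, b, a * b}, fun x => by
      simp only [Finset.mem_insert, Finset.mem_singleton]
      by_cases hx1 : x = 1
      · exact Or.inl hx1
      by_cases hxa : x = a
      · exact Or.inr (Or.inl hxa)
      rcases h x b hx1 hxa hb1 hba with hx | hx
      · exact Or.inr (Or.inr (Or.inl ((eq_inv_of_mul_eq_one_left hx).trans hb')))
      · exact Or.inr (Or.inr (Or.inr (by rw [eq_mul_inv_of_mul_eq hx, hb'])))⟩
    have hcard : Nat.card G = 4 := by
      rw [Nat.card_eq_fintype_card]
      change Finset.card {1, a, b, a * b} = 4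
      have hab : a * b ≠ 1 := fun h0 =>
        hba.symm ((eq_inv_of_mul_eq_one_left h0).trans hb')
      rw [Finset.card_insert_of_notMem, Finset.card_insert_of_notMem,
        Finset.card_insert_of_notMem, Finset.card_singleton]
      all_goals simp [ha, hb1, ha.symm, hb1.symm, hba.symm, hab.symm]
    have : IsKleinFour G := ⟨hcard, by
      refine (Nat.dvd_prime Nat.prime_two).1 (Monoid.exponent_dvd_of_forall_pow_eq_one h2)
        |>.resolve_left ?_
      rw [Monoid.exp_eq_one_iff]
      intro h
      exact ha (h.elim _ _)⟩
    exact IsKleinFour.nonempty_mulEquiv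
  · left
    push Not at hb
    have : Nat.card G = 2 := by
      rw [Nat.card_eq_two_iff]
      refine ⟨1, a, ha.symm, ?_⟩
      ext x
      simp only [Set.mem_insert_iff, Set.mem_singleton_iff, Set.mem_univ, iff_true]
      by_cases hx : x = 1
      · exact Or.inl hx
      · exact Or.inr (hb x hx)
    exact ⟨mulEquivOfPrimeCardEq (p := 2) this (by simp)⟩

/-- In A₄, D₄ and V₄ every involution commutes with a second one. This and the next two lemmas
exclude these groups when z ↦ -z commutes with no other involution in the automorphism group. -/
theorem forall_alternatingGroup_exists_commuting (a : alternatingGroup (Fin 4)) (h2 : a ^ 2 = 1)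
    (h1 : a ≠ 1) : ∃ b, b ≠ 1 ∧ b ≠ a ∧ b ^ 2 = 1 ∧ a * b = b * a := by
  revert a
  decide

theorem forall_dihedralGroup_exists_commuting (a : DihedralGroup 4) (h2 : a ^ 2 = 1)
    (h1 : a ≠ 1) : ∃ b, b ≠ 1 ∧ b ≠ a ∧ b ^ 2 = 1 ∧ a * b = b * a := by
  revert a
  decide

theorem forall_klein_exists_commuting (a : Multiplicative (ZMod 2) × Multiplicative (ZMod 2)) :
    ∃ b, b ≠ 1 ∧ b ≠ a ∧ b ^ 2 = 1 ∧ a * b = b * a := by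
  have h : ∀ x y : Multiplicative (ZMod 2), ∃ z w : Multiplicative (ZMod 2),
      (z, w) ≠ 1 ∧ (z, w) ≠ (x, y) := by decide
  have h2 : ∀ x : Multiplicative (ZMod 2) × Multiplicative (ZMod 2), x ^ 2 = 1 := by decide
  obtain ⟨z, w, h1, ha⟩ := h a.1 a.2
  exact ⟨(z, w), h1, ha, h2 _, mul_comm _ _⟩

theorem exists_alternatingGroup_orderOf_three : ∃ a : alternatingGroup (Fin 4), orderOf a = 3 := by
  have h : ∃ a : alternatingGroup (Fin 4), a ^ 3 = 1 ∧ a ≠ 1 := by decide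
  obtain ⟨a, h3, h1⟩ := h
  exact ⟨a, orderOf_eq_prime h3 h1⟩

theorem exists_orderOf_eq_three : ∃ a : Multiplicative (ZMod 3), orderOf a = 3 := by
  have h : ∃ a : Multiplicative (ZMod 3), a ^ 3 = 1 ∧ a ≠ 1 := by decide
  obtain ⟨a, h3, h1⟩ := h
  exact ⟨a, orderOf_eq_prime h3 h1⟩

end Groups

/-! ### Involutions of PGL₂(k) and the centralizer of z ↦ -z -/

section Involutions

variable {k : Type*} [Field k]

/-- The involution `z ↦ l / z`. -/
noncomputable def pglAnti (l : kˣ) : PGL(2, k) := pgl 0 (l : k) 1 0 (by simp)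

theorem pglAnti_mul_pglAnti (l m : kˣ) : pglAnti l * pglAnti m = pglDiag (l / m) := by
  rw [pglAnti, pglAnti, pglDiag_apply, pgl_mul, pgl_eq_iff]
  refine ⟨(m : k)⁻¹, inv_ne_zero m.ne_zero, ?_, ?_, ?_, ?_⟩ <;> simp [div_eq_inv_mul]

theorem pglDiag_mul_pglAnti (l m : kˣ) : pglDiag l * pglAnti m = pglAnti (l * m) := by
  rw [pglAnti, pglAnti, pglDiag_apply, pgl_mul]
  exact pgl_congr (by simp) (by simp) (by simp) (by simp)

theorem pglAnti_mul_pglDiag (l m : kˣ) : pglAnti l * pglDiag m = pglAnti (l / m) := by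
  rw [pglAnti, pglAnti, pglDiag_apply, pgl_mul, pgl_eq_iff]
  refine ⟨(m : k)⁻¹, inv_ne_zero m.ne_zero, ?_, ?_, ?_, ?_⟩ <;> simp [div_eq_inv_mul]

theorem pglAnti_sq (l : kˣ) : pglAnti l ^ 2 = 1 := by
  rw [pow_two, pglAnti_mul_pglAnti, div_self', map_one]

theorem pglAnti_ne_pglDiag (l m : kˣ) : pglAnti l ≠ pglDiag m := by
  rw [pglAnti, pglDiag_apply, Ne, pgl_eq_iff]
  rintro ⟨u, hu, h, -⟩
  simp at h

theorem inversion_eq : RationalFunction.inversion k = pglAnti 1 := by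
  rw [RationalFunction.inversion, pglAnti]
  exact pgl_congr rfl (by simp) rfl rfl

theorem negation_sq : RationalFunction.negation k ^ 2 = 1 := by
  rw [RationalFunction.negation, ← map_pow]
  simp

theorem pglDiag_sq_eq_one {u : kˣ} (h : pglDiag u ^ 2 = 1) :
    pglDiag u = 1 ∨ pglDiag u = RationalFunction.negation k := by
  rw [← map_pow, map_eq_one_iff _ pglDiag_injective, Units.ext_iff, Units.val_pow_eq_pow_val,
    Units.val_one, sq_eq_one_iff] at h
  exact h.imp (fun h => by rw [show u = 1 from Units.ext h, map_one])
    (fun h => by rw [show u = -1 from Units.ext h, RationalFunction.negation])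

variable [CharZero k]

theorem negation_ne_one : RationalFunction.negation k ≠ 1 := by
  rw [RationalFunction.negation, Ne, map_eq_one_iff _ pglDiag_injective]
  intro h
  have := congrArg Units.val h
  rw [Units.val_neg, Units.val_one] at this
  exact two_ne_zero (α := k) (by linear_combination -this)

/-- Commuting in PGL₂(k) is commuting of matrices up to a scalar u. A nonzero diagonal entry forces
u = 1 and a nonzero off-diagonal entry forces u = -1, so only one kind occurs. -/
theorem eq_pglDiag_or_eq_pglAnti {σ : PGL(2, k)}
    (h : σ * RationalFunction.negation k = RationalFunction.negation k * σ) :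
    (∃ u, σ = pglDiag u) ∨ ∃ l, σ = pglAnti l := by
  obtain ⟨a, b, c, d, hd, rfl⟩ := exists_eq_pgl σ
  rw [RationalFunction.negation_eq, pgl_mul, pgl_mul, pgl_eq_iff] at h
  obtain ⟨u, hu, h1, h2, h3, h4⟩ := h
  simp only [mul_neg, mul_one, mul_zero, add_zero, neg_mul, zero_mul, one_mul, zero_add,
    neg_inj] at h1 h2 h3 h4
  by_cases ha : a = 0
  · right
    subst ha
    have hb : b ≠ 0 := by rintro rfl; simp at hd
    have hc : c ≠ 0 := by rintro rfl; simp at hd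
    have hu' : u = -1 := by
      apply mul_right_cancel₀ hb; linear_combination -h2
    have hd' : d = 0 := by
      subst hu'
      exact (mul_eq_zero_iff_left (two_ne_zero (α := k))).1 (by linear_combination h4)
    subst hd'
    refine ⟨Units.mk0 (b / c) (div_ne_zero hb hc), pgl_eq_iff.2 ⟨c⁻¹, inv_ne_zero hc, ?_⟩⟩
    simp [hc, div_eq_inv_mul]
  · left
    have hu' : u = 1 := by
      apply mul_right_cancel₀ ha; linear_combination -h1
    subst hu'
    have hb : b = 0 := by
      exact (mul_eq_zero_iff_left (two_ne_zero (α := k))).1 (by linear_combination -h2)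
    have hc : c = 0 := by
      exact (mul_eq_zero_iff_left (two_ne_zero (α := k))).1 (by linear_combination h3)
    subst hb hc
    have hd' : d ≠ 0 := by rintro rfl; simp at hd
    refine ⟨Units.mk0 (a / d) (div_ne_zero ha hd'), ?_⟩
    rw [pglDiag_apply, pgl_eq_iff]
    refine ⟨d⁻¹, inv_ne_zero hd', ?_⟩
    simp [hd', div_eq_inv_mul]

end Involutions

/-! ### Automorphism groups of exponent two and Klein four-groups -/

namespace RationalFunction

variable {k : Type*} [Field k]

theorem HasCoeffs.mem_aut {φ : RationalFunction k 3} {p q : Fin 4 → k} {a b c d e : k}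
    (h : φ.HasCoeffs p q) (hd : a * d - b * c ≠ 0) (H : Twist p q p q a b c d e) :
    pgl a b c d hd ∈ φ.Aut := H.intertwines h h hd

theorem HasCoeffs.negation_mem_aut_of_odd {φ : RationalFunction k 3} {a b c d : k}
    (h : φ.HasCoeffs ![a, 0, b, 0] ![0, c, 0, d]) : negation k ∈ φ.Aut := by
  rw [negation_eq]
  refine h.mem_aut (e := 1) _ ⟨?_, ?_⟩ <;> ext i <;> fin_cases i <;> simp [cubicSubst]
  ring

theorem HasCoeffs.negation_mem_aut_of_odd' {φ : RationalFunction k 3} {a b c d : k}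
    (h : φ.HasCoeffs ![0, c, 0, d] ![a, 0, b, 0]) : negation k ∈ φ.Aut := by
  rw [negation_eq]
  refine h.mem_aut (e := -1) _ ⟨?_, ?_⟩ <;> ext i <;> fin_cases i <;> simp [cubicSubst]
  ring

theorem HasCoeffs.inversion_mem_aut_L₁ {φ : RationalFunction k 3} {t : k}
    (h : φ.HasCoeffs ![1, 0, t, 0] ![0, t, 0, 1]) : pglAnti 1 ∈ φ.Aut := by
  refine h.mem_aut (e := 1) _ ⟨?_, ?_⟩ <;> ext i <;> fin_cases i <;> simp [cubicSubst]

theorem HasCoeffs.inversion_mem_aut_L₂ {φ : RationalFunction k 3} {t e : k} (he : e ^ 2 = 1)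
    (h : φ.HasCoeffs ![0, t, 0, e] ![1, 0, e * t, 0]) : pglAnti 1 ∈ φ.Aut := by
  refine h.mem_aut (e := e) _ ⟨?_, ?_⟩ <;> ext i <;> fin_cases i <;> simp [cubicSubst] <;> grind

variable [CharZero k]

theorem exists_klein {ψ : RationalFunction k 3} {l : kˣ} (hn : negation k ∈ ψ.Aut)
    (hl : pglAnti l ∈ ψ.Aut) : ∃ f : Multiplicative (ZMod 2) × Multiplicative (ZMod 2) →* ψ.Aut,
      Function.Injective f := by
  refine exists_injective_of_commuting_involutions (a := ⟨_, hn⟩) (b := ⟨_, hl⟩) ?_ ?_ ?_ ?_ ?_ ?_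
  all_goals simp only [Ne, Subtype.ext_iff, Subgroup.coe_one, Subgroup.coe_pow, Subgroup.coe_mul]
  · exact negation_ne_one
  · rw [← map_one pglDiag]
    exact pglAnti_ne_pglDiag _ _
  · exact (pglAnti_ne_pglDiag _ _).symm
  · exact negation_sq
  · exact pglAnti_sq l
  · rw [negation, pglDiag_mul_pglAnti, pglAnti_mul_pglDiag]
    congr 1
    ext
    simp [div_neg]

variable [IsAlgClosed k]

theorem exists_negation_mem_aut {φ : RationalFunction k 3} {σ : PGL(2, k)} (hσ : σ ∈ φ.Aut)
    (h2 : σ ^ 2 = 1) (h1 : σ ≠ 1) :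
    ∃ τ ψ, φ.Intertwines ψ τ ∧ σ = τ * negation k * τ⁻¹ ∧ negation k ∈ ψ.Aut := by
  obtain ⟨τ, ψ, u, hψ, rfl, hu⟩ := exists_diag_of_mem_aut hσ
  rw [conj_pow, conj_eq_one_iff] at h2
  rw [Ne, conj_eq_one_iff] at h1
  have := (pglDiag_sq_eq_one h2).resolve_left h1
  rw [this] at hu ⊢
  exact ⟨τ, ψ, hψ, rfl, hu⟩

/-- A group of exponent two is abelian, so once z ↦ -z belongs to it, every other nontrivial element
is some l/z. The product of two of these is diagonal of square one, hence 1 or -z, as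
`nonempty_mulEquiv_of_mul_mem` requires. -/
theorem aut_of_exponent_two {φ : RationalFunction k 3} (h : ∀ σ ∈ φ.Aut, σ ^ 2 = 1) :
    Nonempty (φ.Aut ≃* Unit) ∨ Nonempty (φ.Aut ≃* Multiplicative (ZMod 2)) ∨
      Nonempty (φ.Aut ≃* Multiplicative (ZMod 2) × Multiplicative (ZMod 2)) := by
  by_cases htriv : ∀ σ ∈ φ.Aut, σ = 1
  · left
    have : Unique φ.Aut := ⟨⟨1⟩, fun σ => Subtype.ext (htriv _ σ.2)⟩
    exact ⟨MulEquiv.ofUnique⟩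
  right
  push Not at htriv
  obtain ⟨σ, hσ, hσ1⟩ := htriv
  obtain ⟨τ, ψ, hψ, -, hn⟩ := exists_negation_mem_aut hσ (h σ hσ) hσ1
  have h2 : ∀ ρ : ψ.Aut, ρ ^ 2 = 1 := fun ρ => by
    have := h _ (hψ.mem_aut_iff.1 ρ.2)
    rw [conj_pow, conj_eq_one_iff] at this
    exact Subtype.ext this
  have hcomm : ∀ ρ ∈ ψ.Aut, ρ * negation k = negation k * ρ := fun ρ hρ =>
    congrArg Subtype.val (mul_comm_of_forall_sq_eq_one h2 ⟨ρ, hρ⟩ ⟨_, hn⟩)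
  have hne : (⟨negation k, hn⟩ : ψ.Aut) ≠ 1 := fun h => negation_ne_one (congrArg Subtype.val h)
  have key : ∀ ρ : ψ.Aut, ρ ≠ 1 → ρ ≠ ⟨negation k, hn⟩ → ∃ l, ρ.1 = pglAnti l := by
    intro ρ h1 h3
    rcases eq_pglDiag_or_eq_pglAnti (hcomm ρ ρ.2) with ⟨u, hu⟩ | hl
    · have h4 : ρ.1 ^ 2 = 1 := congrArg Subtype.val (h2 ρ)
      rw [hu] at h4
      rcases pglDiag_sq_eq_one h4 with h5 | h5
      · exact (h1 (Subtype.ext (hu.trans h5))).elim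
      · exact (h3 (Subtype.ext (hu.trans h5))).elim
    · exact hl
  have := nonempty_mulEquiv_of_mul_mem hne h2 (by
    intro x y hx hxa hy hya
    obtain ⟨l, hl⟩ := key x hx hxa
    obtain ⟨m, hm⟩ := key y hy hya
    have hxy : (x * y).1 = pglDiag (l / m) := by
      rw [← pglAnti_mul_pglAnti, ← hl, ← hm]; rfl
    have h4 : (x * y).1 ^ 2 = 1 := congrArg Subtype.val (h2 (x * y))
    rw [hxy] at h4
    exact (pglDiag_sq_eq_one h4).imp (fun h5 => Subtype.ext (hxy.trans h5))
      (fun h5 => Subtype.ext (hxy.trans h5)))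
  exact this.imp (fun ⟨e⟩ => ⟨hψ.autEquiv.trans e⟩) (fun ⟨e⟩ => ⟨hψ.autEquiv.trans e⟩)

/-- Move the first involution to z ↦ -z. The second commutes with it and differs from it, so it is
some l/z, and conjugation by z ↦ rz with r² = l makes it 1/z. -/
theorem isL₄_or_isL₅_of_klein {φ : RationalFunction k 3}
    {f : Multiplicative (ZMod 2) × Multiplicative (ZMod 2) →* φ.Aut} (hf : Function.Injective f) :
    ∃ t, φ.IsL₄ t ∨ φ.IsL₅ t := by
  obtain ⟨⟨a, ha⟩, ⟨b, hb⟩, ha1, hb1, hab, ha2, hb2, hc⟩ := exists_commuting_involutions hf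
  simp only [Ne, Subtype.ext_iff, Subgroup.coe_one, Subgroup.coe_pow, Subgroup.coe_mul]
    at ha1 hb1 hab ha2 hb2 hc
  obtain ⟨τ, ψ, hψ, rfl, hn⟩ := exists_negation_mem_aut ha ha2 ha1
  obtain ⟨b, rfl⟩ : ∃ b', b = τ * b' * τ⁻¹ := ⟨τ⁻¹ * b * τ, by simp [mul_assoc]⟩
  rw [← hψ.mem_aut_iff] at hb
  rw [conj_eq_one_iff] at hb1
  rw [conj_pow, conj_eq_one_iff] at hb2
  have hc' : b * negation k = negation k * b := by
    simp only [mul_assoc, inv_mul_cancel_left, mul_right_inj] at hc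
    simpa [← mul_assoc] using hc.symm
  have hbl : ∃ l, b = pglAnti l := by
    rcases eq_pglDiag_or_eq_pglAnti hc' with ⟨u, rfl⟩ | hl
    · rcases pglDiag_sq_eq_one hb2 with h | h
      · exact (hb1 h).elim
      · exact (hab (by rw [h])).elim
    · exact hl
  obtain ⟨l, rfl⟩ := hbl
  obtain ⟨r, hr⟩ := IsAlgClosed.exists_pow_nat_eq (l : k) (n := 2) (by norm_num)
  have hr0 : r ≠ 0 := by
    rintro rfl
    rw [zero_pow two_ne_zero] at hr
    exact l.ne_zero hr.symm
  obtain ⟨χ, hχ⟩ := ψ.exists_intertwines (pglDiag (Units.mk0 r hr0))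
  have h1 : negation k ∈ χ.Aut := by
    rw [hχ.mem_aut_iff, negation, ← map_mul, mul_comm, map_mul, mul_inv_cancel_right]
    exact hn
  have h2 : inversion k ∈ χ.Aut := by
    rw [hχ.mem_aut_iff, inversion_eq, ← map_inv, pglDiag_mul_pglAnti, pglAnti_mul_pglDiag]
    convert hb
    ext
    simp [← hr, pow_two]
  obtain ⟨t, ht⟩ := isL₄_or_isL₅_of_mem_aut h1 h2
  have hcc := (isConj_iff.2 ⟨_, hψ⟩).trans (isConj_iff.2 ⟨_, hχ⟩)
  exact ⟨t, ht.imp hcc.isConjToCubic hcc.isConjToCubic⟩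

theorem HasCoeffs.pglAnti_mem_aut_L₁ {φ : RationalFunction k 3} {t s : k}
    (h : φ.HasCoeffs ![1, 0, t, 0] ![0, s, 0, 1]) (hl : ∃ l, pglAnti l ∈ φ.Aut) : t = s := by
  obtain ⟨l, hl⟩ := hl
  rw [pglAnti] at hl
  obtain ⟨e, he, H1, H2⟩ := Intertwines.exists_twist h h hl
  have a1 := congrFun H1 1
  have b0 := congrFun H2 0
  simp [cubicSubst] at a1 b0
  apply mul_right_cancel₀ l.ne_zero
  rw [a1, ← b0]
  ring

/-- Comparing coefficients gives el = 1 and e = l³, so l⁴ = 1, and also s l² = t. -/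
theorem HasCoeffs.pglAnti_mem_aut_L₂ {φ : RationalFunction k 3} {t s : k}
    (h : φ.HasCoeffs ![0, s, 0, 1] ![1, 0, t, 0]) (hl : ∃ l, pglAnti l ∈ φ.Aut) :
    t ^ 2 = s ^ 2 := by
  obtain ⟨l, hl⟩ := hl
  rw [pglAnti] at hl
  have hl0 := l.ne_zero
  generalize_proofs hd at hl
  generalize (l : k) = v at *
  obtain ⟨e, he, H1, H2⟩ := Intertwines.exists_twist h h hl
  have a0 := congrFun H1 0
  have a2 := congrFun H1 2
  have b1 := congrFun H2 1
  have b3 := congrFun H2 3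
  simp [cubicSubst] at a0 a2 b1 b3
  grind

/-- This realizes the case l² = -1 of the preceding equations: the automorphism is z ↦ i/z. -/
theorem HasCoeffs.pglAnti_mem_aut_neg {φ : RationalFunction k 3} {t : k}
    (h : φ.HasCoeffs ![0, t, 0, 1] ![1, 0, -t, 0]) : ∃ l, pglAnti l ∈ φ.Aut := by
  obtain ⟨i, hi⟩ := IsAlgClosed.exists_pow_nat_eq (-1 : k) (n := 2) (by norm_num)
  have hi0 : i ≠ 0 := by
    rintro rfl
    simp at hi
  refine ⟨Units.mk0 i hi0, h.mem_aut (e := -i) _ ⟨?_, ?_⟩⟩ <;> ext j <;> fin_cases j <;>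
    simp [cubicSubst] <;> grind

end RationalFunction

/-! ### The automorphisms of L₇ and L₃ -/

namespace RationalFunction

variable {k : Type*} [Field k] [IsAlgClosed k] [CharZero k]

/-- The first coefficient identity reads (cx + dy)³ = bx³ + ay³. The absence of middle terms gives
cd = 0, so σ preserves {0, ∞}; the other coefficients give u⁴ = 1. -/
theorem HasCoeffs.mem_aut_L₇ {ψ : RationalFunction k 3}
    (h : ψ.HasCoeffs ![0, 0, 0, 1] ![1, 0, 0, 0]) (σ : PGL(2, k)) :
    σ ∈ ψ.Aut ↔ ∃ u : kˣ, u ^ 4 = 1 ∧ (σ = pglDiag u ∨ σ = pglAnti u) := by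
  constructor
  · intro hσ
    obtain ⟨a, b, c, d, hd, rfl, H1, H2⟩ := Intertwines.exists_normalized_twist h h hσ
    have a0 := congrFun H1 0
    have a1 := congrFun H1 1
    have a3 := congrFun H1 3
    have b0 := congrFun H2 0
    have b3 := congrFun H2 3
    simp [cubicSubst] at a0 a1 a3 b0 b3
    rcases a1 with rfl | rfl
    · obtain rfl : b = 0 := by rw [← a0]; simp
      have ha : a ≠ 0 := by rintro rfl; simp at hd
      have hd' : d ≠ 0 := by rintro rfl; simp at hd
      refine ⟨Units.mk0 (a / d) (div_ne_zero ha hd'), ?_, Or.inl ?_⟩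
      · ext
        simp only [Units.val_pow_eq_pow_val, Units.val_mk0, Units.val_one]
        field_simp
        linear_combination a * b0 - d * a3
      · rw [pglDiag_apply, pgl_eq_iff]
        refine ⟨d⁻¹, inv_ne_zero hd', ?_⟩
        simp [hd', div_eq_inv_mul]
    · obtain rfl : a = 0 := by rw [← a3]; simp
      have hb : b ≠ 0 := by rintro rfl; simp at hd
      have hc : c ≠ 0 := by rintro rfl; simp at hd
      refine ⟨Units.mk0 (b / c) (div_ne_zero hb hc), ?_, Or.inr ?_⟩
      · ext
        simp only [Units.val_pow_eq_pow_val, Units.val_mk0, Units.val_one]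
        field_simp
        linear_combination b * b3 - c * a0
      · rw [pglAnti, pgl_eq_iff]
        refine ⟨c⁻¹, inv_ne_zero hc, ?_⟩
        simp [hc, div_eq_inv_mul]
  · rintro ⟨u, hu, rfl | rfl⟩
    · have hu' : (u : k) ^ 4 = 1 := by rw [← Units.val_pow_eq_pow_val, hu, Units.val_one]
      have hu0 := u.ne_zero
      rw [pglDiag_apply]
      refine h.mem_aut (e := (u : k) ^ 3) _ ⟨?_, ?_⟩ <;> ext j <;> fin_cases j <;>
        simp [cubicSubst]
      linear_combination -hu'
    · have hu' : (u : k) ^ 4 = 1 := by rw [← Units.val_pow_eq_pow_val, hu, Units.val_one]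
      have hu0 := u.ne_zero
      refine h.mem_aut (e := (u : k) ^ 3) _ ⟨?_, ?_⟩ <;> ext j <;> fin_cases j <;>
        simp [cubicSubst]
      linear_combination -hu'

theorem HasCoeffs.aut_L₇ {ψ : RationalFunction k 3}
    (h : ψ.HasCoeffs ![0, 0, 0, 1] ![1, 0, 0, 0]) : Nonempty (ψ.Aut ≃* DihedralGroup 4) := by
  obtain ⟨i, hi⟩ := IsAlgClosed.exists_pow_nat_eq (-1 : k) (n := 2) (by norm_num)
  have hi0 : i ≠ 0 := by
    rintro rfl
    simp at hi
  have hord : orderOf (Units.mk0 i hi0) = 4 := orderOf_unit_of_sq hi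
  generalize Units.mk0 i hi0 = u at hord
  have hu4 : u ^ 4 = 1 := by rw [← hord, pow_orderOf_eq_one]
  let χ : AddChar (ZMod 4) kˣ := AddChar.zmodChar 4 hu4
  have hχ4 : ∀ j, χ j ^ 4 = 1 := fun j => by
    rw [← AddChar.map_nsmul_eq_pow, show (4 : ℕ) • j = 0 by revert j; decide, AddChar.map_zero_eq_one]
  have hχ1 : ∀ j, χ j = 1 → j = 0 := fun j hj => by
    have hj' : u ^ j.val = 1 := hj
    rw [← orderOf_dvd_iff_pow_eq_one, hord] at hj'
    have := j.val_lt
    exact (ZMod.val_eq_zero j).1 (Nat.eq_zero_of_dvd_of_lt hj' this)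
  have hsurj : ∀ v : kˣ, v ^ 4 = 1 → ∃ j, χ j = v := fun v hv => by
    have hp : IsPrimitiveRoot (u : k) 4 :=
      IsPrimitiveRoot.coe_units_iff.2 (hord ▸ IsPrimitiveRoot.orderOf u)
    obtain ⟨n, hn, hv'⟩ := hp.eq_pow_of_pow_eq_one (ξ := (v : k))
      (by rw [← Units.val_pow_eq_pow_val, hv, Units.val_one])
    obtain rfl : u ^ n = v := Units.ext (by rw [Units.val_pow_eq_pow_val, hv'])
    refine ⟨n, ?_⟩
    change u ^ (n : ZMod 4).val = u ^ n
    rw [ZMod.val_natCast_of_lt hn]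
  -- The sign in χ(-j) matches the convention that `sr i * sr j` is `r (j - i)`, since the product
  -- of l/z and m/z is (l/m)z.
  let f : DihedralGroup 4 → ψ.Aut := fun
    | .r j => ⟨pglDiag (χ j), (h.mem_aut_L₇ _).2 ⟨_, hχ4 _, Or.inl rfl⟩⟩
    | .sr j => ⟨pglAnti (χ (-j)), (h.mem_aut_L₇ _).2 ⟨_, hχ4 _, Or.inr rfl⟩⟩
  have hf : ∀ x y, f (x * y) = f x * f y := by
    rintro (i | i) (j | j) <;> apply Subtype.ext
    · change pglDiag (χ (i + j)) = pglDiag (χ i) * pglDiag (χ j)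
      rw [AddChar.map_add_eq_mul, map_mul]
    · change pglAnti (χ (-(j - i))) = pglDiag (χ i) * pglAnti (χ (-j))
      rw [pglDiag_mul_pglAnti, ← AddChar.map_add_eq_mul, neg_sub, sub_eq_add_neg]
    · change pglAnti (χ (-(i + j))) = pglAnti (χ (-i)) * pglDiag (χ j)
      rw [pglAnti_mul_pglDiag, ← AddChar.map_sub_eq_div, neg_add']
    · change pglDiag (χ (j - i)) = pglAnti (χ (-i)) * pglAnti (χ (-j))
      rw [pglAnti_mul_pglAnti, ← AddChar.map_sub_eq_div]
      congr 2
      ring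
  refine ⟨(MulEquiv.ofBijective (MonoidHom.mk' f hf) ⟨?_, ?_⟩).symm⟩
  · rw [injective_iff_map_eq_one]
    rintro (j | j) hj
    · have hj' : pglDiag (χ j) = 1 := congrArg Subtype.val hj
      rw [map_eq_one_iff _ pglDiag_injective] at hj'
      rw [hχ1 j hj']
      rfl
    · have hj' : pglAnti (χ (-j)) = 1 := congrArg Subtype.val hj
      rw [← map_one pglDiag] at hj'
      exact (pglAnti_ne_pglDiag _ _ hj').elim
  · rintro ⟨σ, hσ⟩
    obtain ⟨v, hv, rfl | rfl⟩ := (h.mem_aut_L₇ _).1 hσ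
    · obtain ⟨j, rfl⟩ := hsurj v hv
      exact ⟨.r j, rfl⟩
    · obtain ⟨j, rfl⟩ := hsurj v hv
      refine ⟨.sr (-j), Subtype.ext ?_⟩
      change pglAnti (χ (- -j)) = _
      rw [neg_neg]

/-- If σ fixes ∞, that is c = 0, the equations for the denominator make it diagonal. If c ≠ 0, they
give both ta² = -1 and 3a² = -1, hence t = 3. In that case c ≠ 0 is all that is needed later, to
recognize the stabilizer of ∞. -/
theorem HasCoeffs.mem_aut_L₃ {ψ : RationalFunction k 3} {t : k} (ht : t ≠ 0)
    (h : ψ.HasCoeffs ![1, 0, 0, -t] ![0, -t, 0, 0]) {σ : PGL(2, k)} (hσ : σ ∈ ψ.Aut) :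
    (∃ u : kˣ, u ^ 3 = 1 ∧ σ = pglDiag u) ∨
      (t = 3 ∧ ∃ a b c d, ∃ hd : a * d - b * c ≠ 0, c ≠ 0 ∧ σ = pgl a b c d hd) := by
  obtain ⟨a, b, c, d, hd, rfl, H1, H2⟩ := Intertwines.exists_normalized_twist h h hσ
  have a0 := congrFun H1 0
  have a3 := congrFun H1 3
  have b0 := congrFun H2 0
  have b1 := congrFun H2 1
  have b2 := congrFun H2 2
  have b3 := congrFun H2 3
  simp [cubicSubst, ht] at a0 a3 b0 b1 b2 b3
  replace b1 : a ^ 2 * d + 2 * a * b * c = d := mul_left_cancel₀ ht (by linear_combination b1)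
  replace b3 : b ^ 2 * d = c := mul_left_cancel₀ ht (by linear_combination b3)
  by_cases hc : c = 0
  · left
    subst hc
    have ha : a ≠ 0 := by rintro rfl; simp at hd
    have hd' : d ≠ 0 := by rintro rfl; simp at hd
    have hb : b = 0 := by simpa [hd'] using b3
    subst hb
    have ha2 : a ^ 2 = 1 := mul_right_cancel₀ hd' (by linear_combination b1)
    refine ⟨Units.mk0 (a / d) (div_ne_zero ha hd'), ?_, ?_⟩
    · ext
      simp only [Units.val_pow_eq_pow_val, Units.val_mk0, Units.val_one]
      field_simp
      apply mul_left_cancel₀ ht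
      linear_combination t * a * ha2 + a3
    · rw [pglDiag_apply, pgl_eq_iff]
      refine ⟨d⁻¹, inv_ne_zero hd', ?_⟩
      simp [hd', div_eq_inv_mul]
  · right
    refine ⟨?_, a, b, c, d, hd, hc, rfl⟩
    have hb : b ≠ 0 := by rintro rfl; apply hc; rw [← b3]; simp
    have hd' : d ≠ 0 := by rintro rfl; apply hc; rw [← b3]; simp
    have hbc : 2 * a * d + b * c = 0 := by
      apply (mul_eq_zero_iff_left hb).1; linear_combination b2
    have hta : t * a ^ 2 = -1 := by
      apply mul_right_cancel₀ hc; linear_combination -b0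
    have h3 : 3 * a ^ 2 = -1 := by
      apply mul_right_cancel₀ hd'
      linear_combination -b1 + 2 * a * hbc
    have ha : a ^ 2 ≠ 0 := by intro h; rw [h] at h3; simp at h3
    apply mul_right_cancel₀ ha
    rw [hta, h3]

end RationalFunction

/-! ### Fixed points and the automorphism groups of L₃ and L₆ -/

/-- A group acting faithfully and transitively on four points with point stabilizers of order three
is the alternating group on four letters. -/
theorem nonempty_mulEquiv_alternatingGroup {G X : Type*} [Group G] [MulAction G X]
    [FaithfulSMul G X] [MulAction.IsPretransitive G X] (hX : Nat.card X = 4) (x : X)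
    (hx : Nat.card (MulAction.stabilizer G x) = 3) :
    Nonempty (G ≃* alternatingGroup (Fin 4)) := by
  classical
  have : Finite X := Nat.finite_of_card_ne_zero (by omega)
  have hG : Nat.card G = 12 := by
    rw [← (MulAction.stabilizer G x).card_mul_index, hx, MulAction.index_stabilizer_of_transitive,
      hX]
  let e : X ≃ Fin 4 := Finite.equivFinOfCardEq hX
  let f : G →* Equiv.Perm (Fin 4) :=
    (e.permCongrHom.toMonoidHom).comp (MulAction.toPermHom G X)
  have hf : Function.Injective f := e.permCongrHom.injective.comp MulAction.toPerm_injective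
  have hcard : Nat.card f.range = 12 := by
    rw [← hG]
    exact (Nat.card_congr (MonoidHom.ofInjective hf).toEquiv).symm
  -- A subgroup of order 12 in S₄ has index 2, and A₄ is the only such subgroup.
  have hindex : f.range.index = 2 := by
    have h := f.range.card_mul_index
    rw [hcard, Nat.card_perm, Nat.card_eq_fintype_card, Fintype.card_fin] at h
    have : Nat.factorial 4 = 24 := rfl
    omega
  exact ⟨(MonoidHom.ofInjective hf).trans
    (MulEquiv.subgroupCongr (Equiv.Perm.eq_alternatingGroup_of_index_eq_two hindex))⟩

namespace RationalFunction

variable {k : Type*} [Field k]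

/-- The fixed points of `φ`. -/
def fixedPoints (φ : RationalFunction k 3) : Set (ℙ k (Fin 2 → k)) := {P | φ.toMap P = P}

instance (φ : RationalFunction k 3) : MulAction φ.Aut φ.fixedPoints where
  smul σ P := ⟨σ.1 • P.1, by
    have h := σ.2 P.1
    rw [show φ.toMap P.1 = P.1 from P.2] at h
    exact h⟩
  one_smul P := Subtype.ext (one_smul _ P.1)
  mul_smul σ τ P := Subtype.ext (mul_smul σ.1 τ.1 P.1)

theorem coe_smul_fixedPoints (φ : RationalFunction k 3) (σ : φ.Aut) (P : φ.fixedPoints) :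
    ((σ • P : φ.fixedPoints) : ℙ k (Fin 2 → k)) = σ.1 • P.1 := rfl

/-- The point `[x : 1]`. -/
noncomputable def affinePoint (x : k) : ℙ k (Fin 2 → k) :=
  Projectivization.mk k ![x, 1] (fun h => by simpa using congrFun h 1)

/-- The point `[1 : 0]`. -/
noncomputable def infinityPoint (k : Type*) [Field k] : ℙ k (Fin 2 → k) :=
  Projectivization.mk k ![1, 0] (fun h => by simpa using congrFun h 0)

theorem affinePoint_injective : Function.Injective (affinePoint (k := k)) := by
  intro x y h
  rw [affinePoint, affinePoint, Projectivization.mk_eq_mk_iff'] at h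
  obtain ⟨a, ha⟩ := h
  have h0 := congrFun ha 0
  have h1 := congrFun ha 1
  simp at h0 h1
  rw [← h0, h1, one_mul]

theorem affinePoint_ne_infinityPoint (x : k) : affinePoint x ≠ infinityPoint k := by
  intro h
  rw [affinePoint, infinityPoint, Projectivization.mk_eq_mk_iff'] at h
  obtain ⟨a, ha⟩ := h
  have h1 := congrFun ha 1
  simp at h1

theorem eq_infinityPoint_or_eq_affinePoint (P : ℙ k (Fin 2 → k)) :
    P = infinityPoint k ∨ ∃ x, P = affinePoint x := by
  induction P using Projectivization.ind with | _ v hv =>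
  by_cases h1 : v 1 = 0
  · left
    rw [infinityPoint, Projectivization.mk_eq_mk_iff']
    refine ⟨v 0, ?_⟩
    ext i
    fin_cases i <;> simp [h1]
  · right
    refine ⟨v 0 / v 1, ?_⟩
    rw [affinePoint, Projectivization.mk_eq_mk_iff']
    refine ⟨v 1, ?_⟩
    ext i
    fin_cases i <;> simp
    field_simp

theorem pglDiag_smul_infinityPoint (u : kˣ) : pglDiag u • infinityPoint k = infinityPoint k := by
  rw [infinityPoint, pglDiag_apply]
  obtain ⟨hw, h⟩ := pgl_smul_mk (a := (u : k)) (b := 0) (c := 0) (d := 1) (by simp)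
    (v := ![1, 0]) (fun h => by simpa using congrFun h 0)
  rw [h, Projectivization.mk_eq_mk_iff']
  refine ⟨u, ?_⟩
  ext i
  fin_cases i <;> simp

theorem pglDiag_smul_affinePoint (u : kˣ) (x : k) :
    pglDiag u • affinePoint x = affinePoint (u * x) := by
  rw [affinePoint, pglDiag_apply]
  obtain ⟨hw, h⟩ := pgl_smul_mk (a := (u : k)) (b := 0) (c := 0) (d := 1) (by simp)
    (v := ![x, 1]) (fun h => by simpa using congrFun h 1)
  rw [h, affinePoint, Projectivization.mk_eq_mk_iff']
  refine ⟨1, ?_⟩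
  ext i
  fin_cases i <;> simp

theorem pgl_smul_infinityPoint {a b c d : k} (hd : a * d - b * c ≠ 0) (hc : c ≠ 0) :
    pgl a b c d hd • infinityPoint k = affinePoint (a / c) := by
  rw [infinityPoint]
  obtain ⟨hw, h⟩ := pgl_smul_mk hd (v := ![1, 0]) (fun h => by simpa using congrFun h 0)
  rw [h, affinePoint, Projectivization.mk_eq_mk_iff']
  refine ⟨c, ?_⟩
  ext i
  fin_cases i <;> simp
  field_simp

theorem HasCoeffs.infinityPoint_mem_fixedPoints {ψ : RationalFunction k 3}
    (h : ψ.HasCoeffs ![1, 0, 0, -3] ![0, -3, 0, 0]) : infinityPoint k ∈ ψ.fixedPoints := by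
  change Projectivization.mk k (ψ.evalVec _) _ = Projectivization.mk k _ _
  rw [Projectivization.mk_eq_mk_iff']
  refine ⟨1, ?_⟩
  rw [h.evalVec_eq]
  ext i
  fin_cases i <;> simp [cubicValue]

theorem HasCoeffs.affinePoint_mem_fixedPoints {ψ : RationalFunction k 3}
    (h : ψ.HasCoeffs ![1, 0, 0, -3] ![0, -3, 0, 0]) {x : k} :
    affinePoint x ∈ ψ.fixedPoints ↔ 4 * x ^ 3 = 3 := by
  change Projectivization.mk k (ψ.evalVec _) _ = Projectivization.mk k _ _ ↔ _
  rw [Projectivization.mk_eq_mk_iff', h.evalVec_eq]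
  constructor
  · rintro ⟨a, ha⟩
    have h0 := congrFun ha 0
    have h1 := congrFun ha 1
    simp [cubicValue] at h0 h1
    rw [h1] at h0
    linear_combination -h0
  · intro hx
    refine ⟨-3 * x ^ 2, ?_⟩
    ext i
    fin_cases i <;> simp [cubicValue]
    linear_combination -hx

theorem HasCoeffs.pglDiag_mem_aut_L₃ {ψ : RationalFunction k 3} {t : k}
    (h : ψ.HasCoeffs ![1, 0, 0, -t] ![0, -t, 0, 0]) {u : kˣ} (hu : u ^ 3 = 1) :
    pglDiag u ∈ ψ.Aut := by
  have hu' : (u : k) ^ 3 = 1 := by rw [← Units.val_pow_eq_pow_val, hu, Units.val_one]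
  rw [pglDiag_apply]
  refine h.mem_aut (e := (u : k) ^ 2) _ ⟨?_, ?_⟩ <;> ext j <;> fin_cases j <;>
    simp [cubicSubst]
  · ring
  · linear_combination -t * hu'
  · ring

variable [IsAlgClosed k] [CharZero k]

theorem HasCoeffs.aut_L₃ {ψ : RationalFunction k 3} {t : k} (ht : t ≠ 0) (ht3 : t ≠ 3)
    (h : ψ.HasCoeffs ![1, 0, 0, -t] ![0, -t, 0, 0]) :
    Nonempty (ψ.Aut ≃* Multiplicative (ZMod 3)) := by
  let f : rootsOfUnity 3 k →* ψ.Aut :=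
    (pglDiag.comp (rootsOfUnity 3 k).subtype).codRestrict ψ.Aut
      fun u => h.pglDiag_mem_aut_L₃ ((mem_rootsOfUnity 3 u.1).1 u.2)
  have hf : Function.Bijective f := by
    constructor
    · intro u v huv
      exact Subtype.ext (pglDiag_injective (congrArg Subtype.val huv))
    · rintro ⟨σ, hσ⟩
      rcases h.mem_aut_L₃ ht hσ with ⟨u, hu, rfl⟩ | ⟨h3, -⟩
      · exact ⟨⟨u, (mem_rootsOfUnity 3 u).2 hu⟩, rfl⟩
      · exact (ht3 h3).elim
  have hcard : Nat.card ψ.Aut = 3 := by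
    rw [← Nat.card_congr (Equiv.ofBijective f hf)]
    exact HasEnoughRootsOfUnity.natCard_rootsOfUnity k 3
  have : Fact (Nat.Prime 3) := ⟨Nat.prime_three⟩
  exact ⟨mulEquivOfPrimeCardEq (p := 3) hcard (by simp)⟩

/-- The fixed points are ∞ and the three roots of 4x³ = 3. The stabilizer of ∞ is the group of cube
roots of unity, and explicit involutions carry ∞ to every other fixed point. -/
theorem HasCoeffs.aut_L₆ {ψ : RationalFunction k 3}
    (h : ψ.HasCoeffs ![1, 0, 0, -3] ![0, -3, 0, 0]) :
    Nonempty (ψ.Aut ≃* alternatingGroup (Fin 4)) := by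
  obtain ⟨w, hw⟩ := IsAlgClosed.exists_pow_nat_eq (3 / 4 : k) (n := 3) (by norm_num)
  have hw4 : 4 * w ^ 3 = 3 := by rw [hw]; norm_num
  have hw0 : w ≠ 0 := by
    rintro rfl
    norm_num at hw4
  let x₀ : ψ.fixedPoints := ⟨infinityPoint k, h.infinityPoint_mem_fixedPoints⟩
  -- the stabilizer of infinity consists of the rotations of order three
  have hinf : ∀ σ ∈ ψ.Aut, σ • infinityPoint k = infinityPoint k →
      ∃ u : kˣ, u ^ 3 = 1 ∧ σ = pglDiag u := by
    intro σ hσ hfix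
    rcases h.mem_aut_L₃ three_ne_zero hσ with hu | ⟨-, a, b, c, d, hd, hc, rfl⟩
    · exact hu
    · rw [pgl_smul_infinityPoint hd hc] at hfix
      exact (affinePoint_ne_infinityPoint _ hfix).elim
  -- Fixing ∞ makes an automorphism z ↦ uz, and fixing w ≠ 0 as well forces u = 1.
  have hfaith : FaithfulSMul ψ.Aut ψ.fixedPoints := by
    rw [faithfulSMul_iff]
    rintro ⟨σ, hσ⟩ hfix
    obtain ⟨u, hu, rfl⟩ := hinf σ hσ (congrArg Subtype.val (hfix x₀))
    have hwfix := congrArg Subtype.val (hfix ⟨affinePoint w, h.affinePoint_mem_fixedPoints.2 hw4⟩)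
    rw [coe_smul_fixedPoints, pglDiag_smul_affinePoint] at hwfix
    have huw := affinePoint_injective hwfix
    have hu1 : u = 1 := Units.ext (mul_right_cancel₀ hw0 (by simpa using huw))
    apply Subtype.ext
    simp [hu1]
  have htrans : ∀ P : ψ.fixedPoints, ∃ σ : ψ.Aut, σ • x₀ = P := by
    rintro ⟨P, hP⟩
    rcases eq_infinityPoint_or_eq_affinePoint P with rfl | ⟨x, rfl⟩
    · exact ⟨1, one_smul _ _⟩
    · rw [h.affinePoint_mem_fixedPoints] at hP
      have hx0 : x ≠ 0 := by
        rintro rfl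
        norm_num at hP
      have hd : x * (-x) - (2 * x ^ 2) * 1 ≠ 0 := by
        rw [show x * (-x) - (2 * x ^ 2) * 1 = (-3) * x ^ 2 by ring]
        exact mul_ne_zero (by norm_num) (pow_ne_zero 2 hx0)
      -- This is the involution exchanging ∞ and x. The entry 2x² comes from 2ad + bc = 0, which
      -- holds for automorphisms with c ≠ 0.
      refine ⟨⟨pgl x (2 * x ^ 2) 1 (-x) hd, h.mem_aut (e := -3 * x ^ 2) _ ⟨?_, ?_⟩⟩, ?_⟩
      · ext j
        fin_cases j <;> simp [cubicSubst] <;> grind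
      · ext j
        fin_cases j <;> simp [cubicSubst] <;> grind
      · apply Subtype.ext
        rw [coe_smul_fixedPoints, pgl_smul_infinityPoint hd one_ne_zero, div_one]
  have htr : MulAction.IsPretransitive ψ.Aut ψ.fixedPoints :=
    MulAction.IsPretransitive.of_orbit htrans
  have hstab : Nat.card (MulAction.stabilizer ψ.Aut x₀) = 3 := by
    let f : rootsOfUnity 3 k → MulAction.stabilizer ψ.Aut x₀ := fun u =>
      ⟨⟨pglDiag u.1, h.pglDiag_mem_aut_L₃ ((mem_rootsOfUnity 3 u.1).1 u.2)⟩,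
        Subtype.ext (pglDiag_smul_infinityPoint u.1)⟩
    have hf : Function.Bijective f := by
      constructor
      · intro u v huv
        exact Subtype.ext (pglDiag_injective (congrArg (fun σ => σ.1.1) huv))
      · rintro ⟨⟨σ, hσ⟩, hfix⟩
        obtain ⟨u, hu, rfl⟩ := hinf σ hσ (congrArg Subtype.val hfix)
        exact ⟨⟨u, (mem_rootsOfUnity 3 u).2 hu⟩, rfl⟩
    rw [← Nat.card_congr (Equiv.ofBijective f hf)]
    exact HasEnoughRootsOfUnity.natCard_rootsOfUnity k 3
  have hfour : Nat.card ψ.fixedPoints = 4 := by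
    have hwu : ∀ u : rootsOfUnity 3 k, 4 * ((u.1 : k) * w) ^ 3 = 3 := fun u => by
      have hu' : (u.1 : k) ^ 3 = 1 := by
        rw [← Units.val_pow_eq_pow_val, (mem_rootsOfUnity 3 u.1).1 u.2, Units.val_one]
      rw [mul_pow, hu', one_mul, hw4]
    -- The value at `none` is ∞, and the cube roots of unity times w are the affine fixed points.
    let f : Option (rootsOfUnity 3 k) → ψ.fixedPoints := fun o =>
      o.elim x₀ fun u => ⟨affinePoint ((u.1 : k) * w), h.affinePoint_mem_fixedPoints.2 (hwu u)⟩
    have hf : Function.Bijective f := by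
      constructor
      · rintro (_ | u) (_ | v) huv
        · rfl
        · exact (affinePoint_ne_infinityPoint _ (congrArg Subtype.val huv).symm).elim
        · exact (affinePoint_ne_infinityPoint _ (congrArg Subtype.val huv)).elim
        · have huv' := mul_right_cancel₀ hw0 (affinePoint_injective (congrArg Subtype.val huv))
          exact congrArg some (Subtype.ext (Units.ext huv'))
      · rintro ⟨P, hP⟩
        rcases eq_infinityPoint_or_eq_affinePoint P with rfl | ⟨x, rfl⟩
        · exact ⟨none, rfl⟩
        · rw [h.affinePoint_mem_fixedPoints] at hP
          have hx0 : x ≠ 0 := by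
            rintro rfl
            norm_num at hP
          refine ⟨some ⟨Units.mk0 (x / w) (div_ne_zero hx0 hw0), ?_⟩, Subtype.ext ?_⟩
          · rw [mem_rootsOfUnity]
            ext
            simp only [Units.val_pow_eq_pow_val, Units.val_mk0, Units.val_one]
            rw [div_pow, div_eq_one_iff_eq (pow_ne_zero 3 hw0)]
            linear_combination (hP - hw4) / 4
          · change affinePoint (x / w * w) = affinePoint x
            rw [div_mul_cancel₀ _ hw0]
    have := Nat.card_congr (Equiv.ofBijective f hf)
    rw [← this, Finite.card_option]
    rw [HasEnoughRootsOfUnity.natCard_rootsOfUnity k 3]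
  exact nonempty_mulEquiv_alternatingGroup hfour x₀ hstab

end RationalFunction

/-! ### Exceptional parameters of L₄ and L₅ -/

namespace RationalFunction

variable {k : Type*} [Field k]

/-- The witnesses are square roots of involutions in the Klein four-group: the square is z ↦ -1/z
for t = 3 and z ↦ 1/z for t = -3. -/
theorem order_four_mem_aut_L₅ {ψ : RationalFunction k 3} {t : k} (ht : t ^ 2 = 9)
    {i : k} (hi : i ^ 2 = -1) [CharZero k] (h : ψ.HasCoeffs ![0, t, 0, -1] ![1, 0, -t, 0]) :
    ∃ σ ∈ ψ.Aut, σ ^ 2 ≠ 1 := by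
  have ht' : (t - 3) * (t + 3) = 0 := by linear_combination ht
  rcases mul_eq_zero.1 ht' with ht' | ht'
  · obtain rfl : t = 3 := by linear_combination ht'
    have hd : (1 : k) * 1 - 1 * (-1) ≠ 0 := by norm_num
    refine ⟨pgl 1 1 (-1) 1 hd, h.mem_aut (e := -2) hd ⟨?_, ?_⟩, ?_⟩
    · ext j
      fin_cases j <;> simp [cubicSubst] <;> ring
    · ext j
      fin_cases j <;> simp [cubicSubst] <;> ring
    · rw [pow_two, pgl_mul, Ne, pgl_eq_one_iff]
      norm_num
  · obtain rfl : t = -3 := by linear_combination ht'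
    have hd : (1 : k) * 1 - (-i) * (-i) ≠ 0 := by
      rw [show (1 : k) * 1 - (-i) * (-i) = 2 by linear_combination -hi]
      exact two_ne_zero
    have hi0 : i ≠ 0 := by
      rintro rfl
      simp at hi
    refine ⟨pgl 1 (-i) (-i) 1 hd, h.mem_aut (e := -2) hd ⟨?_, ?_⟩, ?_⟩
    · ext j
      fin_cases j <;> simp [cubicSubst] <;> grind
    · ext j
      fin_cases j <;> simp [cubicSubst] <;> grind
    · rw [pow_two, pgl_mul, Ne, pgl_eq_one_iff]
      intro h
      have h1 : (-2 : k) * i = 0 := by linear_combination h.1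
      simp [hi0] at h1

/-- The witness z ↦ (z + i)/(z - i) has order three and permutes cyclically the pairs {0, ∞}, {1,
-1}, {i, -i} of fixed points of the involutions -z, 1/z, -1/z. -/
theorem order_three_mem_aut_L₅ {ψ : RationalFunction k 3} {t : k} (ht : t ^ 2 = -3)
    {i : k} (hi : i ^ 2 = -1) [CharZero k] (h : ψ.HasCoeffs ![0, t, 0, -1] ![1, 0, -t, 0]) :
    ∃ σ ∈ ψ.Aut, σ ^ 2 ≠ 1 := by
  have hi0 : i ≠ 0 := by
    rintro rfl
    simp at hi
  have hd : (1 : k) * (-i) - i * 1 ≠ 0 := by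
    rw [show (1 : k) * (-i) - i * 1 = (-2) * i by ring]
    exact mul_ne_zero (by norm_num) hi0
  refine ⟨pgl 1 i 1 (-i) hd, h.mem_aut (e := -i * (t - 1)) hd ⟨?_, ?_⟩, ?_⟩
  · ext j
    fin_cases j <;> simp [cubicSubst] <;> grind
  · ext j
    fin_cases j <;> simp [cubicSubst] <;> grind
  · rw [pow_two, pgl_mul, Ne, pgl_eq_one_iff]
    intro h
    have h1 : i = 1 := by linear_combination -h.2.1
    rw [h1] at hi
    exact two_ne_zero (α := k) (by linear_combination hi)

variable [IsAlgClosed k] [CharZero k]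

/-- Both maps have the fixed-point quartic x⁴ - y⁴, so its invariants cannot detect t. The vanishing
of the x³y and x²y² coefficients shows that σ is diagonal or antidiagonal, and then a middle
coefficient of the cubics yields t = 0. -/
theorem eq_zero_of_L₄_of_L₇ {ψ χ : RationalFunction k 3} {t : k} {σ : PGL(2, k)}
    (hψ : ψ.HasCoeffs ![0, t, 0, 1] ![1, 0, t, 0]) (hχ : χ.HasCoeffs ![0, 0, 0, 1] ![1, 0, 0, 0])
    (H : ψ.Intertwines χ σ) : t = 0 := by
  obtain ⟨a, b, c, d, hd, rfl, H1, H2⟩ := H.exists_normalized_twist hψ hχ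
  have a0 := congrFun H1 0
  have a1 := congrFun H1 1
  have a2 := congrFun H1 2
  have a3 := congrFun H1 3
  have b0 := congrFun H2 0
  have b1 := congrFun H2 1
  have b2 := congrFun H2 2
  have b3 := congrFun H2 3
  simp [cubicSubst] at a0 a1 a2 a3 b0 b1 b2 b3
  -- the form `x ^ 4 - y ^ 4` cutting out the fixed points is preserved up to a scalar
  have e1 : a ^ 3 * b = c ^ 3 * d := by
    linear_combination (a * b1 + b * b0 - c * a1 - d * a0) / 4
  have e2 : a ^ 2 * b ^ 2 = c ^ 2 * d ^ 2 := by
    linear_combination (a * b2 + b * b1 - c * a2 - d * a1) / 6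
  have hab : a * b = 0 := by
    by_contra hab
    have ha := left_ne_zero_of_mul hab
    have hb := right_ne_zero_of_mul hab
    have hc : c ≠ 0 := by
      rintro rfl
      exact mul_ne_zero (pow_ne_zero 3 ha) hb (by linear_combination e1)
    apply hd
    apply (mul_eq_zero_iff_left (mul_ne_zero (mul_ne_zero hc (pow_ne_zero 2 ha)) hb)).1
    linear_combination c * d * e1 - c ^ 2 * e2
  have hcd : c * d = 0 := by
    rw [← pow_eq_zero_iff two_ne_zero, mul_pow, ← e2, ← mul_pow, hab]
    simp
  rcases mul_eq_zero.1 hab with rfl | rfl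
  · have hb : b ≠ 0 := by rintro rfl; simp at hd
    have hc : c ≠ 0 := by rintro rfl; simp at hd
    obtain rfl : d = 0 := by simpa [hc] using hcd
    simpa [hb, hc] using a2
  · have ha : a ≠ 0 := by rintro rfl; simp at hd
    have hd' : d ≠ 0 := by rintro rfl; simp at hd
    obtain rfl : c = 0 := by simpa [hd'] using hcd
    simpa [ha, hd'] using a1

/-- The fixed-point quartics are x⁴ - y⁴ and -4x³y + 3y⁴. The equations `e0`, `e2`, `e3` express
that x⁴, x²y² and xy³ are missing from the latter; together they make σ singular. -/
theorem not_L₄_of_L₆ {ψ χ : RationalFunction k 3} {t : k} {σ : PGL(2, k)}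
    (hψ : ψ.HasCoeffs ![0, t, 0, 1] ![1, 0, t, 0])
    (hχ : χ.HasCoeffs ![1, 0, 0, -3] ![0, -3, 0, 0])
    (H : ψ.Intertwines χ σ) : False := by
  obtain ⟨a, b, c, d, hd, rfl, H1, H2⟩ := H.exists_normalized_twist hψ hχ
  have a0 := congrFun H1 0
  have a1 := congrFun H1 1
  have a2 := congrFun H1 2
  have a3 := congrFun H1 3
  have b0 := congrFun H2 0
  have b1 := congrFun H2 1
  have b2 := congrFun H2 2
  have b3 := congrFun H2 3
  simp [cubicSubst] at a0 a1 a2 a3 b0 b1 b2 b3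
  have e0 : a ^ 4 = c ^ 4 := by linear_combination a * b0 - c * a0
  have e2 : a ^ 2 * b ^ 2 = c ^ 2 * d ^ 2 := by
    linear_combination (a * b2 + b * b1 - c * a2 - d * a1) / 6
  have e3 : a * b ^ 3 = c * d ^ 3 := by
    linear_combination (a * b3 + b * b2 - c * a3 - d * a2) / 4
  have ha : a ≠ 0 := by
    rintro rfl
    have hc : c = 0 := by
      rw [← pow_eq_zero_iff four_ne_zero, ← e0]; simp
    simp [hc] at hd
  have hc : c ≠ 0 := by
    rintro rfl
    exact ha (by rw [← pow_eq_zero_iff four_ne_zero, e0]; simp)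
  have hdd : d ≠ 0 := by
    rintro rfl
    have hb : b = 0 := by simpa [ha] using e3
    simp [hb] at hd
  have hb : b ≠ 0 := by
    rintro rfl
    exact mul_ne_zero hc (pow_ne_zero 3 hdd) (by linear_combination -e3)
  apply hd
  apply (mul_eq_zero_iff_left (mul_ne_zero (mul_ne_zero ha (pow_ne_zero 2 hb)) hdd)).1
  linear_combination d ^ 2 * e2 - c * d * e3

theorem sq_of_L₅_of_L₆ {ψ χ : RationalFunction k 3} {t : k} {σ : PGL(2, k)}
    (hψ : ψ.HasCoeffs ![0, t, 0, -1] ![1, 0, -t, 0])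
    (hχ : χ.HasCoeffs ![1, 0, 0, -3] ![0, -3, 0, 0])
    (H : ψ.Intertwines χ σ) : t ^ 2 = -3 := by
  obtain ⟨a, b, c, d, hd, rfl, H1, H2⟩ := H.exists_normalized_twist hψ hχ
  have a0 := congrFun H1 0
  have a1 := congrFun H1 1
  have a2 := congrFun H1 2
  have a3 := congrFun H1 3
  have b0 := congrFun H2 0
  have b1 := congrFun H2 1
  have b2 := congrFun H2 2
  have b3 := congrFun H2 3
  simp [cubicSubst] at a0 a1 a2 a3 b0 b1 b2 b3
  have e0 : a ^ 4 - 2 * t * (a ^ 2 * c ^ 2) + c ^ 4 = 0 := by linear_combination a * b0 - c * a0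
  have e2 : 6 * (a ^ 2 * b ^ 2) - 2 * t * (a ^ 2 * d ^ 2 + 4 * a * b * c * d + b ^ 2 * c ^ 2) +
      6 * (c ^ 2 * d ^ 2) = 0 := by
    linear_combination a * b2 + b * b1 - c * a2 - d * a1
  have e3 : 4 * (a * b ^ 3) - 2 * t * (2 * a * b * d ^ 2 + 2 * b ^ 2 * c * d) +
      4 * (c * d ^ 3) = 0 := by
    linear_combination a * b3 + b * b2 - c * a3 - d * a2
  -- For a quartic with coefficients A0, …, A4, the expression 12 A0 A4 - 3 A1 A3 + A2² is an
  -- invariant of weight 4. It is 12 + 4t² for x⁴ - 2t x²y² + y⁴ and vanishes for the quartic of L₆,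
  -- where A0 = A2 = A3 = 0.
  have key : (a * d - b * c) ^ 4 * (12 + 4 * t ^ 2) = 0 := by
    linear_combination 12 * (b ^ 4 - 2 * t * (b ^ 2 * d ^ 2) + d ^ 4) * e0 -
      3 * (4 * (a ^ 3 * b) - 2 * t * (2 * a * b * c ^ 2 + 2 * a ^ 2 * c * d) +
        4 * (c ^ 3 * d)) * e3 +
      (6 * (a ^ 2 * b ^ 2) - 2 * t * (a ^ 2 * d ^ 2 + 4 * a * b * c * d + b ^ 2 * c ^ 2) +
        6 * (c ^ 2 * d ^ 2)) * e2
  have := (mul_eq_zero_iff_left (pow_ne_zero 4 hd)).1 key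
  linear_combination this / 4

theorem eq_zero_or_sq_of_L₅_of_L₇ {ψ χ : RationalFunction k 3} {t : k} {σ : PGL(2, k)}
    (hψ : ψ.HasCoeffs ![0, t, 0, -1] ![1, 0, -t, 0])
    (hχ : χ.HasCoeffs ![0, 0, 0, 1] ![1, 0, 0, 0])
    (H : ψ.Intertwines χ σ) : t = 0 ∨ t ^ 2 = 9 := by
  obtain ⟨a, b, c, d, hd, rfl, H1, H2⟩ := H.exists_normalized_twist hψ hχ
  have a0 := congrFun H1 0
  have a1 := congrFun H1 1
  have a2 := congrFun H1 2
  have a3 := congrFun H1 3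
  have b0 := congrFun H2 0
  have b1 := congrFun H2 1
  have b2 := congrFun H2 2
  have b3 := congrFun H2 3
  simp [cubicSubst] at a0 a1 a2 a3 b0 b1 b2 b3
  have e1 : 4 * (a ^ 3 * b) - 2 * t * (2 * a * b * c ^ 2 + 2 * a ^ 2 * c * d) +
      4 * (c ^ 3 * d) = 0 := by
    linear_combination a * b1 + b * b0 - c * a1 - d * a0
  have e2 : 6 * (a ^ 2 * b ^ 2) - 2 * t * (a ^ 2 * d ^ 2 + 4 * a * b * c * d + b ^ 2 * c ^ 2) +
      6 * (c ^ 2 * d ^ 2) = 0 := by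
    linear_combination a * b2 + b * b1 - c * a2 - d * a1
  have e3 : 4 * (a * b ^ 3) - 2 * t * (2 * a * b * d ^ 2 + 2 * b ^ 2 * c * d) +
      4 * (c * d ^ 3) = 0 := by
    linear_combination a * b3 + b * b2 - c * a3 - d * a2
  -- This is the cubic invariant of quartics, of weight 6. Its value at x⁴ - 2t x²y² + y⁴ is 16t(t²
  -- - 9), and it vanishes at the quartic of L₇, where A1 = A2 = A3 = 0. The coefficients are kept
  -- as variables so that these zeros can be inserted.
  have key : ∀ A0 A1 A2 A3 A4 : k, A0 = a ^ 4 - 2 * t * (a ^ 2 * c ^ 2) + c ^ 4 →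
      A1 = 4 * (a ^ 3 * b) - 2 * t * (2 * a * b * c ^ 2 + 2 * a ^ 2 * c * d) + 4 * (c ^ 3 * d) →
      A2 = 6 * (a ^ 2 * b ^ 2) - 2 * t * (a ^ 2 * d ^ 2 + 4 * a * b * c * d + b ^ 2 * c ^ 2) +
        6 * (c ^ 2 * d ^ 2) →
      A3 = 4 * (a * b ^ 3) - 2 * t * (2 * a * b * d ^ 2 + 2 * b ^ 2 * c * d) + 4 * (c * d ^ 3) →
      A4 = b ^ 4 - 2 * t * (b ^ 2 * d ^ 2) + d ^ 4 →
      72 * A0 * A2 * A4 + 9 * A1 * A2 * A3 - 27 * A0 * A3 ^ 2 - 27 * A4 * A1 ^ 2 - 2 * A2 ^ 3 =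
        (a * d - b * c) ^ 6 * (16 * (t * (t ^ 2 - 9))) := by
    rintro _ _ _ _ _ rfl rfl rfl rfl rfl
    ring
  have := key _ 0 0 0 _ rfl e1.symm e2.symm e3.symm rfl
  have h0 : (a * d - b * c) ^ 6 * (16 * (t * (t ^ 2 - 9))) = 0 := by
    rw [← this]; ring
  have h1 := (mul_eq_zero_iff_left (pow_ne_zero 6 hd)).1 h0
  have h2 := (mul_eq_zero_iff_left (by norm_num)).1 h1
  rcases mul_eq_zero.1 h2 with h | h
  · exact Or.inl h
  · exact Or.inr (by linear_combination h)

end RationalFunction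

/-! ### The classification -/

namespace RationalFunction

variable {k : Type*} [Field k]

theorem IsConj.nonempty_autEquiv {φ ψ : RationalFunction k 3} (h : φ.IsConj ψ) :
    Nonempty (φ.Aut ≃* ψ.Aut) := by
  obtain ⟨σ, hσ⟩ := isConj_iff.1 h
  exact ⟨hσ.autEquiv⟩

theorem exists_orderOf_iff {φ : RationalFunction k 3} {G : Type*} [Group G]
    (h : Nonempty (φ.Aut ≃* G)) {n : ℕ} :
    (∃ σ ∈ φ.Aut, orderOf σ = n) ↔ ∃ g : G, orderOf g = n := by
  obtain ⟨e⟩ := h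
  constructor
  · rintro ⟨σ, hσ, h⟩
    exact ⟨e ⟨σ, hσ⟩, by rw [MulEquiv.orderOf_eq, Subgroup.orderOf_mk, h]⟩
  · rintro ⟨g, hg⟩
    exact ⟨e.symm g, (e.symm g).2, by rw [Subgroup.orderOf_coe, MulEquiv.orderOf_eq, hg]⟩

theorem IsL₁.exists_conj {φ : RationalFunction k 3} {t s : k} (h : φ.IsL₁ t s) : ∃ ψ, φ.IsConj ψ ∧
    ψ.HasCoeffs ![1, 0, t, 0] ![0, s, 0, 1] ∧ negation k ∈ ψ.Aut := by
  obtain ⟨ψ, hψ, hc⟩ := isConjToCubic_iff.1 h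
  exact ⟨ψ, hc, hψ, hψ.negation_mem_aut_of_odd⟩

theorem IsL₂.exists_conj {φ : RationalFunction k 3} {t s : k} (h : φ.IsL₂ t s) : ∃ ψ, φ.IsConj ψ ∧
    ψ.HasCoeffs ![0, s, 0, 1] ![1, 0, t, 0] ∧ negation k ∈ ψ.Aut := by
  obtain ⟨ψ, hψ, hc⟩ := isConjToCubic_iff.1 h
  exact ⟨ψ, hc, hψ, hψ.negation_mem_aut_of_odd'⟩

theorem not_exists_klein_of_card {φ : RationalFunction k 3}
    (h : Nat.card φ.Aut = 2 ∨ Nat.card φ.Aut = 3) :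
    ¬ ∃ f : Multiplicative (ZMod 2) × Multiplicative (ZMod 2) →* φ.Aut, Function.Injective f := by
  rintro ⟨f, hf⟩
  have : Finite φ.Aut := Nat.finite_of_card_ne_zero (by omega)
  have := Nat.card_le_card_of_injective f hf
  have h4 : Nat.card (Multiplicative (ZMod 2) × Multiplicative (ZMod 2)) = 4 := by simp
  omega

theorem exists_intertwines_of_isConjToCubic {φ ψ : RationalFunction k 3} {p q : Fin 4 → k}
    (hc : φ.IsConj ψ) (h : φ.IsConjToCubic p q) :
    ∃ χ σ, χ.HasCoeffs p q ∧ ψ.Intertwines χ σ := by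
  obtain ⟨χ, hχ, hc'⟩ := isConjToCubic_iff.1 h
  obtain ⟨σ, hσ⟩ := isConj_iff.1 (hc.symm.trans hc')
  exact ⟨χ, σ, hχ, hσ⟩

variable [CharZero k]

theorem exists_orderOf_two_of_negation {φ ψ : RationalFunction k 3} (hc : φ.IsConj ψ)
    (h : negation k ∈ ψ.Aut) : ∃ σ ∈ φ.Aut, orderOf σ = 2 := by
  rw [exists_orderOf_iff hc.nonempty_autEquiv]
  exact ⟨⟨_, h⟩, by rw [Subgroup.orderOf_mk, orderOf_negation]⟩

theorem exists_klein_of_conj {φ ψ : RationalFunction k 3} {l : kˣ} (hc : φ.IsConj ψ)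
    (hn : negation k ∈ ψ.Aut) (hl : pglAnti l ∈ ψ.Aut) :
    ∃ f : Multiplicative (ZMod 2) × Multiplicative (ZMod 2) →* φ.Aut, Function.Injective f := by
  obtain ⟨e⟩ := hc.nonempty_autEquiv
  obtain ⟨f, hf⟩ := exists_klein hn hl
  exact ⟨e.symm.toMonoidHom.comp f, e.symm.injective.comp hf⟩

theorem IsL₄.exists_klein {φ : RationalFunction k 3} {t : k} (h : φ.IsL₄ t) :
    ∃ f : Multiplicative (ZMod 2) × Multiplicative (ZMod 2) →* φ.Aut, Function.Injective f := by
  obtain ⟨ψ, hc, hψ, hn⟩ := IsL₂.exists_conj h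
  exact exists_klein_of_conj hc hn (HasCoeffs.inversion_mem_aut_L₂ (e := 1) (by simp) (by simpa using hψ))

theorem IsL₅.exists_klein {φ : RationalFunction k 3} {t : k} (h : φ.IsL₅ t) :
    ∃ f : Multiplicative (ZMod 2) × Multiplicative (ZMod 2) →* φ.Aut, Function.Injective f := by
  obtain ⟨ψ, hψ, hc⟩ := isConjToCubic_iff.1 h
  exact exists_klein_of_conj hc hψ.negation_mem_aut_of_odd'
    (HasCoeffs.inversion_mem_aut_L₂ (e := -1) (by simp) (by simpa using hψ))

variable [IsAlgClosed k] {φ : RationalFunction k 3}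

theorem IsL₇.aut (h : φ.IsL₇) : Nonempty (φ.Aut ≃* DihedralGroup 4) := by
  obtain ⟨ψ, hψ, hc⟩ := isConjToCubic_iff.1 h
  obtain ⟨e⟩ := hc.nonempty_autEquiv
  obtain ⟨f⟩ := hψ.aut_L₇
  exact ⟨e.trans f⟩

theorem IsL₆.aut (h : φ.IsL₆) : Nonempty (φ.Aut ≃* alternatingGroup (Fin 4)) := by
  obtain ⟨ψ, hψ, hc⟩ := isConjToCubic_iff.1 h
  obtain ⟨e⟩ := hc.nonempty_autEquiv
  obtain ⟨f⟩ := hψ.aut_L₆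
  exact ⟨e.trans f⟩

theorem IsL₃.aut {t : k} (ht : t ≠ 0) (ht3 : t ≠ 3) (h : φ.IsL₃ t) :
    Nonempty (φ.Aut ≃* Multiplicative (ZMod 3)) := by
  obtain ⟨ψ, hψ, hc⟩ := isConjToCubic_iff.1 h
  obtain ⟨e⟩ := hc.nonempty_autEquiv
  obtain ⟨f⟩ := hψ.aut_L₃ ht ht3
  exact ⟨e.trans f⟩

/-- Either all automorphisms are involutions, or `φ` has one of the normal forms with an
automorphism of order three or four. -/
theorem aut_cases (φ : RationalFunction k 3) :
    (∀ σ ∈ φ.Aut, σ ^ 2 = 1) ∨ (∃ t, t ≠ 0 ∧ t ≠ 3 ∧ φ.IsL₃ t) ∨ φ.IsL₆ ∨ φ.IsL₇ := by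
  by_cases h : ∀ σ ∈ φ.Aut, σ ^ 2 = 1
  · exact Or.inl h
  right
  push Not at h
  obtain ⟨σ, hσ, h2⟩ := h
  rcases orderOf_cases_of_mem_aut hσ with h | ⟨h, -⟩ | ⟨-, t, ht, h⟩ | ⟨-, h⟩
  · rw [orderOf_eq_one_iff] at h
    exact (h2 (by rw [h, one_pow])).elim
  · exact (h2 (orderOf_dvd_iff_pow_eq_one.1 h.dvd)).elim
  · by_cases ht3 : t = 3
    · rw [ht3] at h
      exact Or.inr (Or.inl h)
    · exact Or.inl ⟨t, ht, ht3, h⟩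
  · exact Or.inr (Or.inr h)

theorem aut_classification (φ : RationalFunction k 3) :
    Nonempty (φ.Aut ≃* Unit) ∨ Nonempty (φ.Aut ≃* Multiplicative (ZMod 2)) ∨
      Nonempty (φ.Aut ≃* Multiplicative (ZMod 2) × Multiplicative (ZMod 2)) ∨
      Nonempty (φ.Aut ≃* Multiplicative (ZMod 3)) ∨
      Nonempty (φ.Aut ≃* alternatingGroup (Fin 4)) ∨ Nonempty (φ.Aut ≃* DihedralGroup 4) := by
  rcases φ.aut_cases with h | ⟨t, ht, ht3, h⟩ | h | h
  · rcases aut_of_exponent_two h with h | h | h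
    · exact Or.inl h
    · exact Or.inr (Or.inl h)
    · exact Or.inr (Or.inr (Or.inl h))
  · exact Or.inr (Or.inr (Or.inr (Or.inl (h.aut ht ht3))))
  · exact Or.inr (Or.inr (Or.inr (Or.inr (Or.inl h.aut))))
  · exact Or.inr (Or.inr (Or.inr (Or.inr (Or.inr h.aut))))

theorem exists_orderOf_three_iff :
    (∃ σ ∈ φ.Aut, orderOf σ = 3) ↔ ∃ t : k, t ≠ 0 ∧ φ.IsL₃ t := by
  constructor
  · rintro ⟨σ, hσ, h3⟩
    rcases orderOf_cases_of_mem_aut hσ with h | ⟨h, -⟩ | ⟨-, h⟩ | ⟨h, -⟩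
    · omega
    · omega
    · exact h
    · omega
  · rintro ⟨t, ht, h⟩
    by_cases ht3 : t = 3
    · subst ht3
      rw [exists_orderOf_iff (IsL₆.aut h)]
      exact exists_alternatingGroup_orderOf_three
    · rw [exists_orderOf_iff (h.aut ht ht3)]
      exact exists_orderOf_eq_three

theorem exists_orderOf_four_iff : (∃ σ ∈ φ.Aut, orderOf σ = 4) ↔ φ.IsL₇ := by
  constructor
  · rintro ⟨σ, hσ, h4⟩
    rcases orderOf_cases_of_mem_aut hσ with h | ⟨h, -⟩ | ⟨h, -⟩ | ⟨-, h⟩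
    · omega
    · omega
    · omega
    · exact h
  · intro h
    rw [exists_orderOf_iff h.aut]
    exact ⟨.r 1, DihedralGroup.orderOf_r_one⟩

theorem exists_orderOf_two_iff :
    (∃ σ ∈ φ.Aut, orderOf σ = 2) ↔ ∃ t s : k, t * s ≠ 1 ∧ (φ.IsL₁ t s ∨ φ.IsL₂ t s) := by
  constructor
  · rintro ⟨σ, hσ, h2⟩
    rcases orderOf_cases_of_mem_aut hσ with h | ⟨-, t, s, h⟩ | ⟨h, -⟩ | ⟨h, -⟩
    · omega
    · exact ⟨t, s, h.elim IsL₁.mul_ne_one IsL₂.mul_ne_one, h⟩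
    · omega
    · omega
  · rintro ⟨t, s, -, h | h⟩
    · obtain ⟨ψ, hc, -, hn⟩ := h.exists_conj
      exact exists_orderOf_two_of_negation hc hn
    · obtain ⟨ψ, hc, -, hn⟩ := h.exists_conj
      exact exists_orderOf_two_of_negation hc hn

theorem exists_klein_iff :
    (∃ f : Multiplicative (ZMod 2) × Multiplicative (ZMod 2) →* φ.Aut, Function.Injective f) ↔
      ∃ t : k, t ^ 2 ≠ 1 ∧ (φ.IsL₄ t ∨ φ.IsL₅ t) := by
  constructor
  · rintro ⟨f, hf⟩
    obtain ⟨t, ht⟩ := isL₄_or_isL₅_of_klein hf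
    exact ⟨t, ht.elim IsL₄.sq_ne_one IsL₅.sq_ne_one, ht⟩
  · rintro ⟨t, -, h | h⟩
    · exact h.exists_klein
    · exact h.exists_klein

/-- In the presence of `z ↦ -z`, the automorphism group has order two unless it contains some
`z ↦ l / z`. -/
theorem aut_of_negation_mem {ψ : RationalFunction k 3} (hn : negation k ∈ ψ.Aut)
    (hl : ¬ ∃ l, pglAnti l ∈ ψ.Aut) : Nonempty (ψ.Aut ≃* Multiplicative (ZMod 2)) := by
  -- A further involution commuting with -z would be some l/z, which is excluded.
  have comm : ∀ b : ψ.Aut, b ≠ 1 → b ≠ ⟨_, hn⟩ → b ^ 2 = 1 →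
      (⟨_, hn⟩ : ψ.Aut) * b = b * ⟨_, hn⟩ → False := by
    rintro ⟨b, hb⟩ h1 h2 h3 h4
    rcases eq_pglDiag_or_eq_pglAnti (congrArg Subtype.val h4).symm with ⟨u, rfl⟩ | ⟨l, rfl⟩
    · rcases pglDiag_sq_eq_one (congrArg Subtype.val h3) with h | h
      · exact h1 (Subtype.ext h)
      · exact h2 (Subtype.ext h)
    · exact hl ⟨l, hb⟩
  have transfer : ∀ {G : Type} [Group G], (∀ a : G, a ^ 2 = 1 → a ≠ 1 →
      ∃ b, b ≠ 1 ∧ b ≠ a ∧ b ^ 2 = 1 ∧ a * b = b * a) → ¬ Nonempty (ψ.Aut ≃* G) := by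
    rintro G _ hG ⟨e⟩
    obtain ⟨b, hb1, hba, hb2, hab⟩ := hG (e ⟨_, hn⟩)
      (by rw [← map_pow, map_eq_one_iff _ e.injective]; exact Subtype.ext negation_sq)
      (by
        rw [Ne, map_eq_one_iff _ e.injective]
        exact fun h => negation_ne_one (congrArg Subtype.val h))
    obtain ⟨b, rfl⟩ := e.surjective b
    refine comm b ?_ ?_ ?_ ?_
    · rwa [Ne, map_eq_one_iff _ e.injective] at hb1
    · rwa [Ne, e.injective.eq_iff] at hba
    · rwa [← map_pow, map_eq_one_iff _ e.injective] at hb2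
    · rwa [← map_mul, ← map_mul, e.injective.eq_iff] at hab
  have h2 : ∃ σ ∈ ψ.Aut, orderOf σ = 2 := ⟨_, hn, orderOf_negation⟩
  -- The trivial group and C₃ have no involution, while in V₄, A₄ and D₄ the involution -z would
  -- commute with another one; only C₂ survives.
  rcases ψ.aut_classification with h | h | h | h | h | h
  · rw [exists_orderOf_iff h] at h2
    obtain ⟨g, hg⟩ := h2
    rw [Subsingleton.elim g 1, orderOf_one] at hg
    omega
  · exact h
  · exact (transfer (fun a _ _ => forall_klein_exists_commuting a) h).elim
  · rw [exists_orderOf_iff h] at h2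
    obtain ⟨g, hg⟩ := h2
    have hdvd := orderOf_dvd_natCard g
    rw [hg] at hdvd
    simp at hdvd
  · exact (transfer forall_alternatingGroup_exists_commuting h).elim
  · exact (transfer forall_dihedralGroup_exists_commuting h).elim

/-- The excluded parameters are exactly those with an automorphism l/z: 1/z for t = s, and i/z for t
= -s in L₂. Such an automorphism and -z generate a Klein four-group; without one,
`aut_of_negation_mem` gives C₂. -/
theorem aut_equiv_two_iff : Nonempty (φ.Aut ≃* Multiplicative (ZMod 2)) ↔
    (∃ t s : k, t * s ≠ 1 ∧ t ≠ s ∧ φ.IsL₁ t s) ∨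
      (∃ t s : k, t * s ≠ 1 ∧ t ^ 2 ≠ s ^ 2 ∧ φ.IsL₂ t s) := by
  constructor
  · intro h
    have h2 : ∃ σ ∈ φ.Aut, orderOf σ = 2 := by
      rw [exists_orderOf_iff h]
      exact ⟨Multiplicative.ofAdd 1, orderOf_eq_prime (by decide) (by decide)⟩
    have hk : ¬ ∃ f : Multiplicative (ZMod 2) × Multiplicative (ZMod 2) →* φ.Aut,
        Function.Injective f := by
      obtain ⟨e⟩ := h
      exact not_exists_klein_of_card (Or.inl (by rw [Nat.card_congr e.toEquiv]; simp))
    obtain ⟨t, s, hts, h | h⟩ := exists_orderOf_two_iff.1 h2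
    · refine Or.inl ⟨t, s, hts, ?_, h⟩
      rintro rfl
      obtain ⟨ψ, hc, hψ, hn⟩ := h.exists_conj
      exact hk (exists_klein_of_conj hc hn hψ.inversion_mem_aut_L₁)
    · refine Or.inr ⟨t, s, hts, ?_, h⟩
      intro hsq
      obtain ⟨ψ, hc, hψ, hn⟩ := h.exists_conj
      rcases sq_eq_sq_iff_eq_or_eq_neg.1 hsq with rfl | rfl
      · exact hk (exists_klein_of_conj hc hn
          (HasCoeffs.inversion_mem_aut_L₂ (e := 1) (by simp) (by simpa using hψ)))
      · obtain ⟨l, hl⟩ := hψ.pglAnti_mem_aut_neg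
        exact hk (exists_klein_of_conj hc hn hl)
  · rintro (⟨t, s, -, hts, h⟩ | ⟨t, s, -, hts, h⟩)
    · obtain ⟨ψ, hc, hψ, hn⟩ := h.exists_conj
      obtain ⟨e⟩ := hc.nonempty_autEquiv
      obtain ⟨f⟩ := aut_of_negation_mem hn fun hl => hts (hψ.pglAnti_mem_aut_L₁ hl)
      exact ⟨e.trans f⟩
    · obtain ⟨ψ, hc, hψ, hn⟩ := h.exists_conj
      obtain ⟨e⟩ := hc.nonempty_autEquiv
      obtain ⟨f⟩ := aut_of_negation_mem hn fun hl => hts (hψ.pglAnti_mem_aut_L₂ hl)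
      exact ⟨e.trans f⟩

theorem aut_equiv_three_iff : Nonempty (φ.Aut ≃* Multiplicative (ZMod 3)) ↔
    ∃ t : k, t ≠ 0 ∧ t ≠ 3 ∧ φ.IsL₃ t := by
  constructor
  · intro h
    have h3 : ∃ σ ∈ φ.Aut, orderOf σ = 3 := by
      rw [exists_orderOf_iff h]
      exact exists_orderOf_eq_three
    obtain ⟨t, ht, hL⟩ := exists_orderOf_three_iff.1 h3
    refine ⟨t, ht, ?_, hL⟩
    rintro rfl
    obtain ⟨e⟩ := h
    obtain ⟨f⟩ := IsL₆.aut hL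
    have := Nat.card_congr (e.symm.trans f).toEquiv
    rw [nat_card_alternatingGroup] at this
    simp [Nat.factorial] at this
  · rintro ⟨t, ht, ht3, h⟩
    exact h.aut ht ht3

theorem aut_equiv_alternatingGroup_iff :
    Nonempty (φ.Aut ≃* alternatingGroup (Fin 4)) ↔ φ.IsL₆ := by
  refine ⟨fun h => ?_, IsL₆.aut⟩
  have h3 : ∃ σ ∈ φ.Aut, orderOf σ = 3 := by
    rw [exists_orderOf_iff h]
    exact exists_alternatingGroup_orderOf_three
  obtain ⟨t, ht, hL⟩ := exists_orderOf_three_iff.1 h3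
  by_cases ht3 : t = 3
  · rw [ht3] at hL
    exact hL
  · obtain ⟨e⟩ := h
    obtain ⟨f⟩ := hL.aut ht ht3
    have := Nat.card_congr (e.symm.trans f).toEquiv
    rw [nat_card_alternatingGroup] at this
    simp [Nat.factorial] at this

theorem aut_equiv_dihedralGroup_iff : Nonempty (φ.Aut ≃* DihedralGroup 4) ↔ φ.IsL₇ := by
  refine ⟨fun h => ?_, IsL₇.aut⟩
  rw [← exists_orderOf_four_iff, exists_orderOf_iff h]
  exact ⟨.r 1, DihedralGroup.orderOf_r_one⟩

/-- If a Klein four-group acts and `φ` is conjugate neither to `L₆` nor to `L₇`, then the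
automorphism group is a Klein four-group. -/
theorem aut_equiv_klein_of_not
    (h : ∃ f : Multiplicative (ZMod 2) × Multiplicative (ZMod 2) →* φ.Aut, Function.Injective f)
    (h6 : ¬ φ.IsL₆) (h7 : ¬ φ.IsL₇) :
    Nonempty (φ.Aut ≃* Multiplicative (ZMod 2) × Multiplicative (ZMod 2)) := by
  rcases φ.aut_classification with he | he | he | he | he | he
  · obtain ⟨e⟩ := he
    obtain ⟨f, hf⟩ := h
    have := (e.injective.comp hf) (a₁ := (1, 1)) (a₂ := (Multiplicative.ofAdd 1, 1)) rfl
    exact absurd this (by decide)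
  · obtain ⟨e⟩ := he
    exact (not_exists_klein_of_card (Or.inl (by rw [Nat.card_congr e.toEquiv]; simp)) h).elim
  · exact he
  · obtain ⟨e⟩ := he
    exact (not_exists_klein_of_card (Or.inr (by rw [Nat.card_congr e.toEquiv]; simp)) h).elim
  · exact (h6 (aut_equiv_alternatingGroup_iff.1 he)).elim
  · exact (h7 (aut_equiv_dihedralGroup_iff.1 he)).elim

/-- In V₄ every square is trivial, which excludes L₄(0) and L₅(0), both conjugate to L₇, and the
values t² = 9 and t² = -3, where L₅ has an explicit automorphism of nontrivial square. At all other
parameters the fixed-point quartic prevents conjugacy to L₆ and L₇, and the classification leaves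
only V₄. -/
theorem aut_equiv_klein_iff :
    Nonempty (φ.Aut ≃* Multiplicative (ZMod 2) × Multiplicative (ZMod 2)) ↔
      (∃ t : k, t ^ 2 ≠ 1 ∧ t ≠ 0 ∧ φ.IsL₄ t) ∨
      (∃ t : k, t ^ 2 ≠ 1 ∧ t ≠ 0 ∧ t ^ 2 ≠ 9 ∧ t ^ 2 ≠ -3 ∧ φ.IsL₅ t) := by
  constructor
  · intro h
    have hk : ∃ f : Multiplicative (ZMod 2) × Multiplicative (ZMod 2) →* φ.Aut,
        Function.Injective f := by
      obtain ⟨e⟩ := h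
      exact ⟨e.symm.toMonoidHom, e.symm.injective⟩
    have h2 : ∀ {ψ : RationalFunction k 3}, φ.IsConj ψ → ∀ σ ∈ ψ.Aut, σ ^ 2 = 1 := by
      intro ψ hc σ hσ
      obtain ⟨e⟩ := h
      obtain ⟨f⟩ := hc.nonempty_autEquiv
      have h2 : ∀ x : Multiplicative (ZMod 2) × Multiplicative (ZMod 2), x ^ 2 = 1 := by decide
      have : (⟨σ, hσ⟩ : ψ.Aut) ^ 2 = 1 := by
        apply (f.symm.trans e).injective
        rw [map_pow, map_one, h2]
      exact congrArg Subtype.val this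
    have h7 : ¬ φ.IsL₇ := by
      intro h7
      obtain ⟨σ, hσ, h4⟩ := exists_orderOf_four_iff.2 h7
      have := orderOf_dvd_of_pow_eq_one (h2 (IsConj.refl φ) σ hσ)
      rw [h4] at this
      omega
    obtain ⟨t, ht, hL | hL⟩ := exists_klein_iff.1 hk
    · refine Or.inl ⟨t, ht, ?_, hL⟩
      rintro rfl
      exact h7 hL
    · obtain ⟨ψ, hψ, hc⟩ := isConjToCubic_iff.1 hL
      obtain ⟨i, hi⟩ := IsAlgClosed.exists_pow_nat_eq (-1 : k) (n := 2) (by norm_num)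
      refine Or.inr ⟨t, ht, ?_, ?_, ?_, hL⟩
      · rintro rfl
        rw [neg_zero] at hψ
        exact h7 (hc.isConjToCubic (hψ.isL₇ (by simp) one_ne_zero))
      · intro ht
        obtain ⟨σ, hσ, h⟩ := order_four_mem_aut_L₅ ht hi hψ
        exact h (h2 hc σ hσ)
      · intro ht
        obtain ⟨σ, hσ, h⟩ := order_three_mem_aut_L₅ ht hi hψ
        exact h (h2 hc σ hσ)
  · rintro (⟨t, -, ht, h⟩ | ⟨t, -, ht, ht9, ht3, h⟩)
    · obtain ⟨ψ, hψ, hc⟩ := isConjToCubic_iff.1 h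
      refine aut_equiv_klein_of_not h.exists_klein (fun h6 => ?_) (fun h7 => ?_)
      · obtain ⟨χ, σ, hχ, hσ⟩ := exists_intertwines_of_isConjToCubic hc h6
        exact not_L₄_of_L₆ hψ hχ hσ
      · obtain ⟨χ, σ, hχ, hσ⟩ := exists_intertwines_of_isConjToCubic hc h7
        exact ht (eq_zero_of_L₄_of_L₇ hψ hχ hσ)
    · obtain ⟨ψ, hψ, hc⟩ := isConjToCubic_iff.1 h
      refine aut_equiv_klein_of_not h.exists_klein (fun h6 => ?_) (fun h7 => ?_)
      · obtain ⟨χ, σ, hχ, hσ⟩ := exists_intertwines_of_isConjToCubic hc h6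
        exact ht3 (sq_of_L₅_of_L₆ hψ hχ hσ)
      · obtain ⟨χ, σ, hχ, hσ⟩ := exists_intertwines_of_isConjToCubic hc h7
        exact (eq_zero_or_sq_of_L₅_of_L₇ hψ hχ hσ).elim ht ht9

/-- The bound is what excludes S₄ and A₅, of orders 24 and 60. -/
theorem card_aut_le (φ : RationalFunction k 3) : Nat.card φ.Aut ≤ 12 := by
  rcases φ.aut_classification with h | h | h | h | h | h <;> obtain ⟨e⟩ := h <;>
    rw [Nat.card_congr e.toEquiv]
  · simp
  · simp
  · simp
  · simp
  · rw [nat_card_alternatingGroup]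
    simp [Nat.factorial]
  · rw [DihedralGroup.nat_card]
    norm_num

end RationalFunction

theorem mainTheorem1 {k : Type*} [Field k] [IsAlgClosed k] [CharZero k]
    (φ : RationalFunction k 3) :
    -- every automorphism has order at most four
    (∀ σ ∈ φ.Aut, IsOfFinOrder σ ∧ orderOf σ ≤ 4) ∧
    -- the automorphism group is trivial, `C₂`, `C₃`, `C₄`, `V₄`, `D₄` (of order eight) or `A₄`
    (Nonempty (φ.Aut ≃* Unit) ∨
      Nonempty (φ.Aut ≃* Multiplicative (ZMod 2)) ∨
      Nonempty (φ.Aut ≃* Multiplicative (ZMod 3)) ∨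
      Nonempty (φ.Aut ≃* Multiplicative (ZMod 4)) ∨
      Nonempty (φ.Aut ≃* Multiplicative (ZMod 2) × Multiplicative (ZMod 2)) ∨
      Nonempty (φ.Aut ≃* DihedralGroup 4) ∨
      Nonempty (φ.Aut ≃* alternatingGroup (Fin 4))) ∧
    -- neither `S₄` nor `A₅` occurs
    ¬ Nonempty (φ.Aut ≃* Equiv.Perm (Fin 4)) ∧
    ¬ Nonempty (φ.Aut ≃* alternatingGroup (Fin 5)) ∧
    -- normal forms in the presence of an automorphism of order 2, 3, 4, or of a Klein four-group
    ((∃ σ ∈ φ.Aut, orderOf σ = 2) ↔ ∃ t s : k, t * s ≠ 1 ∧ (φ.IsL₁ t s ∨ φ.IsL₂ t s)) ∧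
    ((∃ σ ∈ φ.Aut, orderOf σ = 3) ↔ ∃ t : k, t ≠ 0 ∧ φ.IsL₃ t) ∧
    ((∃ σ ∈ φ.Aut, orderOf σ = 4) ↔ φ.IsL₇) ∧
    ((∃ f : Multiplicative (ZMod 2) × Multiplicative (ZMod 2) →* φ.Aut, Function.Injective f) ↔
      ∃ t : k, t ^ 2 ≠ 1 ∧ (φ.IsL₄ t ∨ φ.IsL₅ t)) ∧
    -- normal forms for each automorphism group
    (Nonempty (φ.Aut ≃* Multiplicative (ZMod 2)) ↔
      (∃ t s : k, t * s ≠ 1 ∧ t ≠ s ∧ φ.IsL₁ t s) ∨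
      (∃ t s : k, t * s ≠ 1 ∧ t ^ 2 ≠ s ^ 2 ∧ φ.IsL₂ t s)) ∧
    (Nonempty (φ.Aut ≃* Multiplicative (ZMod 3)) ↔ ∃ t : k, t ≠ 0 ∧ t ≠ 3 ∧ φ.IsL₃ t) ∧
    (Nonempty (φ.Aut ≃* Multiplicative (ZMod 2) × Multiplicative (ZMod 2)) ↔
      (∃ t : k, t ^ 2 ≠ 1 ∧ t ≠ 0 ∧ φ.IsL₄ t) ∨
      (∃ t : k, t ^ 2 ≠ 1 ∧ t ≠ 0 ∧ t ^ 2 ≠ 9 ∧ t ^ 2 ≠ -3 ∧ φ.IsL₅ t)) ∧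
    (Nonempty (φ.Aut ≃* alternatingGroup (Fin 4)) ↔ φ.IsL₆) ∧
    (Nonempty (φ.Aut ≃* DihedralGroup 4) ↔ φ.IsL₇) := by
  open RationalFunction in
  refine ⟨fun σ hσ => ?_, ?_, ?_, ?_, exists_orderOf_two_iff, exists_orderOf_three_iff,
    exists_orderOf_four_iff, exists_klein_iff, aut_equiv_two_iff, aut_equiv_three_iff,
    aut_equiv_klein_iff, aut_equiv_alternatingGroup_iff, aut_equiv_dihedralGroup_iff⟩
  · have h : 0 < orderOf σ ∧ orderOf σ ≤ 4 := by
      rcases orderOf_cases_of_mem_aut hσ with h | ⟨h, -⟩ | ⟨h, -⟩ | ⟨h, -⟩ <;> omega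
    exact ⟨orderOf_pos_iff.1 h.1, h.2⟩
  -- The alternative C₄ is never chosen, since an automorphism of order 4 makes the group D₄.
  · rcases φ.aut_classification with h | h | h | h | h | h
    · exact Or.inl h
    · exact Or.inr (Or.inl h)
    · exact Or.inr (Or.inr (Or.inr (Or.inr (Or.inl h))))
    · exact Or.inr (Or.inr (Or.inl h))
    · exact Or.inr (Or.inr (Or.inr (Or.inr (Or.inr (Or.inr h)))))
    · exact Or.inr (Or.inr (Or.inr (Or.inr (Or.inr (Or.inl h)))))
  · rintro ⟨e⟩
    have h := φ.card_aut_le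
    rw [Nat.card_congr e.toEquiv, Nat.card_perm, Nat.card_eq_fintype_card, Fintype.card_fin] at h
    simp [Nat.factorial] at h
  · rintro ⟨e⟩
    have h := φ.card_aut_le
    rw [Nat.card_congr e.toEquiv, nat_card_alternatingGroup] at h
    simp [Nat.factorial] at h
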